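/- For $s\in\mathbb{Q}$ put \begin{align*} c_4 &= -31 \left(s^4 + 42 s^2 - \tfrac{32200}{93} s - 147\right),\\ c_2 &= 2^8 \left(s^8 + 84 s^6 - \tfrac{3472}{3} s^5 + 1470 s^4 - 48608 s^3 + 53508 s^2 + 170128 s + 21609\right),\\ c_0 &= \tfrac{2^{20}\cdot 7}{3}\, s\, (s^2 + 7)^3 (s^2 + 63),\\ d &= s^4 + 42 s^2 + \tfrac{1736}{3} s - 147, \end{align*} and, when $c_0 d\neq 0$, let $C_{24}^s$ be the genus-$2$ curve $d y^2 = x^6 + c_4 x^4 + c_2 x^2 + c_0$ over $\mathbb{Q}$. Let $D$ be the elliptic curve $y^2 = x^3 + 14x^2 + 196x$ over $\mathbb{Q}$. The following three equations define genus-$2$ curves over $\mathbb{Q}$, and the Jacobian of each of them has a $\mathbb{Q}$-rational torsion point of order exactly $48$: \begin{align*} y^2 + (x^2 + x) y &= x^6 - 3 x^5 - 5 x^4 + 14 x^3 + 8 x^2 - 16 x,\\ y^2 + (x^2 + x) y &= x^6 - x^5 + 5 x^4 - 11 x^3 + 10 x^2 - 6 x + 2,\\ y^2 + (x^2 + x)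 y &= 1217 x^6 - 3651 x^5 + 15717859 x^4 - 31429634 x^3 + 60403483004 x^2 - 60387768796 x + 80875050306064. \end{align*} Moreover, these curves are isomorphic over $\mathbb{Q}$ to $C_{24}^{-21}$, $C_{24}^{3}$ and $C_{24}^{21/31}$, respectively (for each of these three values of $s$ one has $c_0 d\ne 0$, and $C_{24}^s$ has genus $2$), and the values $s=-21,\ 3,\ 21/31$ are obtained from the points $(z,w) = (0,0),\ (7,-49),\ (16,-104)$ of $D(\mathbb{Q})$, respectively, by the formula \[ s = -21\,\frac{(z^2 + 196)(z^2 + 56 z + 196) + 32 (z + 14)(z - 14) w}{z^4 - 896 z^3 - 24696 z^2 - 175616 z + 38416}, \] whose denominator is nonzero at each of these points. -/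

import Mathlib

open Polynomial
open scoped WithZero

noncomputable section

/-! ### Divisors on the smooth projective curve with a given function field -/

/-- A point of the smooth projective curve over `K` with function field `F`: a normalized discrete
valuation of `F` which is trivial on `K` (multiplicative notation, so `ord f = -log (v f)`). -/
@[ext]
structure Place (K F : Type*) [Field K] [Field F] [Algebra K F] where
  v : Valuation F ℤᵐ⁰
  surjective : Function.Surjective v
  trivial : ∀ c : K, c ≠ 0 → v (algebraMap K F c) = 1

namespace Place

variable {K F : Type*} [Field K] [Field F] [Algebra K F]

/-- The order of vanishing at `P` of a nonzero function `f` (with junk value `0` at `f = 0`). -/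
def ord (P : Place K F) (f : F) : ℤ := -WithZero.log (P.v f)

/-- The action on points of an automorphism `τ` of `F` that restricts to an automorphism `σ` of
the constant field. -/
def transport (σ : K ≃+* K) (τ : F ≃+* F) (h : ∀ c, τ (algebraMap K F c) = algebraMap K F (σ c)) :
    Place K F ≃ Place K F where
  toFun P :=
    { v := P.v.comap (τ.symm : F →+* F)
      surjective := P.surjective.comp τ.symm.surjective
      trivial := fun c hc => by
        have h1 : τ.symm (algebraMap K F c) = algebraMap K F (σ.symm c) := by
          rw [RingEquiv.symm_apply_eq, h, RingEquiv.apply_symm_apply]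
        simpa [h1] using P.trivial (σ.symm c) (by simpa using hc) }
  invFun P :=
    { v := P.v.comap (τ : F →+* F)
      surjective := P.surjective.comp τ.surjective
      trivial := fun c hc => by
        simpa [h] using P.trivial (σ c) (by simpa using hc) }
  left_inv P := by ext x; simp
  right_inv P := by ext x; simp

end Place

section Pic

variable (K F : Type*) [Field K] [Field F] [Algebra K F]

/-- The group of divisors. -/
abbrev CurveDivisor := Place K F →₀ ℤ

/-- The subgroup of principal divisors: those of the form `div f` with `f` a nonzero function. -/
def principalDivisors : AddSubgroup (CurveDivisor K F) where
  carrier := {D | ∃ f : F, f ≠ 0 ∧ ∀ P : Place K F, D P = P.ord f}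
  zero_mem' := ⟨1, one_ne_zero, fun P => by simp [Place.ord]⟩
  add_mem' := by
    rintro D E ⟨f, hf, hD⟩ ⟨g, hg, hE⟩
    refine ⟨f * g, mul_ne_zero hf hg, fun P => ?_⟩
    have h1 : P.v f ≠ 0 := (Valuation.ne_zero_iff _).2 hf
    have h2 : P.v g ≠ 0 := (Valuation.ne_zero_iff _).2 hg
    rw [Finsupp.add_apply, hD, hE, Place.ord, Place.ord, Place.ord, map_mul,
      WithZero.log_mul h1 h2]
    ring
  neg_mem' := by
    rintro D ⟨f, hf, hD⟩
    refine ⟨f⁻¹, inv_ne_zero hf, fun P => ?_⟩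
    rw [Finsupp.neg_apply, hD, Place.ord, Place.ord, map_inv₀, WithZero.log_inv]

/-- The group of divisor classes. -/
abbrev PicardGroup := CurveDivisor K F ⧸ principalDivisors K F

/-- The group of classes of divisors of degree zero. All points have degree one, since `K` is
algebraically closed. -/
def picardZero [IsAlgClosed K] : AddSubgroup (PicardGroup K F) :=
  (Finsupp.degree (R := ℤ) (σ := Place K F)).ker.map (QuotientAddGroup.mk' (principalDivisors K F))

variable {K F}

/-- The action on divisor classes of an automorphism of `F` that preserves the constant field. -/
def PicardGroup.transport (σ : K ≃+* K) (τ : F ≃+* F)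
    (h : ∀ c, τ (algebraMap K F c) = algebraMap K F (σ c)) : PicardGroup K F →+ PicardGroup K F :=
  QuotientAddGroup.map _ _ (Finsupp.domCongr (Place.transport σ τ h)).toAddMonoidHom (by
    rintro D ⟨f, hf, hD⟩
    refine ⟨τ f, by simpa using hf, fun P => ?_⟩
    change D ((Place.transport σ τ h).symm P) = _
    rw [hD]
    rfl)

end Pic

/-! ### Genus-two curves -/

/-- A curve of genus two over `k`, given by a nonsingular Weierstrass model
`a y² + h(x) y = f(x)` with `deg h ≤ 3`, `deg f ≤ 6`, and `h² + 4 a f` separable of degree `5`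
or `6`. (In characteristic two there are no such models with these conditions.) -/
structure GenusTwoCurve (k : Type*) [Field k] where
  a : k
  h : k[X]
  f : k[X]
  a_ne_zero : a ≠ 0
  natDegree_h_le : h.natDegree ≤ 3
  natDegree_f_le : f.natDegree ≤ 6
  separable : (h ^ 2 + C (4 * a) * f).Separable
  five_le_natDegree : 5 ≤ (h ^ 2 + C (4 * a) * f).natDegree

namespace GenusTwoCurve

variable {k : Type*} [Field k] (X₀ : GenusTwoCurve k)

/-- The polynomial `a Y² + h(X) Y - f(X)`, as a polynomial in `Y` over `k[X]`. -/
def eqn : k[X][X] := C (C X₀.a) * X ^ 2 + C X₀.h * X - C X₀.f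

theorem not_root (g : k[X]) : C X₀.a * g ^ 2 + X₀.h * g - X₀.f ≠ 0 := by
  intro hg
  have key : X₀.h ^ 2 + C (4 * X₀.a) * X₀.f
      = (C (2 * X₀.a) * g + X₀.h) * (C (2 * X₀.a) * g + X₀.h) := by
    have hf : X₀.f = C X₀.a * g ^ 2 + X₀.h * g := (sub_eq_zero.1 hg).symm
    rw [hf]
    simp only [map_mul, map_ofNat]
    ring
  have hs := X₀.separable
  have hd := X₀.five_le_natDegree
  rw [key] at hs hd
  have hu : IsUnit (C (2 * X₀.a) * g + X₀.h) := hs.squarefree _ dvd_rfl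
  rw [natDegree_eq_zero_of_isUnit (hu.mul hu)] at hd
  omega

theorem irreducible_eqn : Irreducible X₀.eqn := by
  have ha := X₀.a_ne_zero
  set m : k[X][X] := X ^ 2 + C (C X₀.a⁻¹ * X₀.h) * X + C (-(C X₀.a⁻¹ * X₀.f)) with hm
  have hca : (C X₀.a * C X₀.a⁻¹ : k[X]) = 1 := by rw [← C_mul, mul_inv_cancel₀ ha, C_1]
  have e : X₀.eqn = C (C X₀.a) * m := by
    have h1 : (C (C X₀.a) * C (C X₀.a⁻¹) : k[X][X]) = 1 := by rw [← C_mul, hca, C_1]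
    simp only [hm, eqn, C_mul, C_neg]
    linear_combination (-(C X₀.h * X) + C X₀.f) * h1
  have hdeg : m.natDegree = 2 := by rw [hm]; compute_degree!
  have hmon : m.Monic := by rw [hm]; monicity!
  have hirr : Irreducible m := by
    rw [hmon.irreducible_iff_roots_eq_zero_of_degree_le_three hdeg.ge (by omega)]
    refine Multiset.eq_zero_of_forall_notMem fun g hg => X₀.not_root g ?_
    have hr : m.eval g = 0 := ((mem_roots hmon.ne_zero).1 hg)
    simp only [hm, eval_add, eval_mul, eval_pow, eval_X, eval_C] at hr
    linear_combination C X₀.a * hr + (-(X₀.h * g) + X₀.f) * hca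
  have hu : IsUnit (C (C X₀.a) : k[X][X]) :=
    isUnit_C.2 (isUnit_C.2 (isUnit_iff_ne_zero.2 ha))
  rw [e]
  exact (irreducible_isUnit_mul hu).2 hirr

/-- The affine coordinate ring `k[x, y] / (a y² + h(x) y - f(x))`. -/
abbrev CoordinateRing : Type _ := AdjoinRoot X₀.eqn

instance : IsDomain X₀.CoordinateRing := AdjoinRoot.isDomain_of_prime X₀.irreducible_eqn.prime

/-- The function field, i.e. the field of fractions of the affine coordinate ring. -/
abbrev FunctionField : Type _ := FractionRing X₀.CoordinateRing

/-- Isomorphism over `k` of (smooth projective) curves: an isomorphism over `k` of their function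
fields. -/
def Isomorphic (X₁ X₂ : GenusTwoCurve k) : Prop :=
  Nonempty (X₁.FunctionField ≃ₐ[k] X₂.FunctionField)

theorem map_discriminant {L : Type*} [Field L] [Algebra k L] :
    (X₀.h ^ 2 + C (4 * X₀.a) * X₀.f).map (algebraMap k L)
      = X₀.h.map (algebraMap k L) ^ 2
        + C (4 * algebraMap k L X₀.a) * X₀.f.map (algebraMap k L) := by
  rw [Polynomial.map_add, Polynomial.map_mul, Polynomial.map_pow, map_C, map_mul]
  congr 4
  exact map_ofNat _ 4

/-- Base change along a field extension. -/
def baseChange (L : Type*) [Field L] [Algebra k L] : GenusTwoCurve L where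
  a := algebraMap k L X₀.a
  h := X₀.h.map (algebraMap k L)
  f := X₀.f.map (algebraMap k L)
  a_ne_zero := by simpa using X₀.a_ne_zero
  natDegree_h_le := by simpa using X₀.natDegree_h_le
  natDegree_f_le := by simpa using X₀.natDegree_f_le
  separable := by
    rw [← map_discriminant]
    exact X₀.separable.map
  five_le_natDegree := by
    rw [← map_discriminant, natDegree_map]
    exact X₀.five_le_natDegree

section Galois

variable {L : Type*} [Field L] [Algebra k L]

theorem eqn_baseChange_map (σ : L ≃ₐ[k] L) :
    (X₀.baseChange L).eqn.map (Polynomial.mapEquiv (σ : L ≃+* L) : L[X] →+* L[X])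
      = (X₀.baseChange L).eqn := by
  have hp : ∀ p : k[X], (p.map (algebraMap k L)).map (σ : L →+* L)
      = p.map (algebraMap k L) := fun p => by
    rw [Polynomial.map_map]
    congr 1
    ext c
    simp
  simp [eqn, baseChange, hp]

/-- The action of `σ` on the affine coordinate ring over `L`: it acts on constants by `σ` and
fixes `x` and `y`. -/
def galoisCoordinateRing (σ : L ≃ₐ[k] L) :
    (X₀.baseChange L).CoordinateRing ≃+* (X₀.baseChange L).CoordinateRing :=
  AdjoinRoot.mapRingEquiv (Polynomial.mapEquiv (σ : L ≃+* L)) _ _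
    (by rw [eqn_baseChange_map])

/-- The action of `σ` on the function field over `L`: it acts on constants by `σ` and
fixes `x` and `y`. -/
def galoisFunctionField (σ : L ≃ₐ[k] L) :
    (X₀.baseChange L).FunctionField ≃+* (X₀.baseChange L).FunctionField :=
  IsFractionRing.ringEquivOfRingEquiv (X₀.galoisCoordinateRing σ)

theorem galoisFunctionField_algebraMap (σ : L ≃ₐ[k] L) (c : L) :
    X₀.galoisFunctionField σ (algebraMap L (X₀.baseChange L).FunctionField c)
      = algebraMap L (X₀.baseChange L).FunctionField ((σ : L ≃+* L) c) := by
  rw [IsScalarTower.algebraMap_apply L (X₀.baseChange L).CoordinateRing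
      (X₀.baseChange L).FunctionField,
    IsScalarTower.algebraMap_apply L (X₀.baseChange L).CoordinateRing
      (X₀.baseChange L).FunctionField, galoisFunctionField,
    IsFractionRing.ringEquivOfRingEquiv_algebraMap]
  congr 1
  simp [galoisCoordinateRing, AdjoinRoot.algebraMap_eq']

/-- The action of `σ` on the divisor classes of the curve over `L`. -/
def galoisPicard (σ : L ≃ₐ[k] L) :
    PicardGroup L (X₀.baseChange L).FunctionField →+ PicardGroup L (X₀.baseChange L).FunctionField :=
  PicardGroup.transport (σ : L ≃+* L) (X₀.galoisFunctionField σ)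
    (X₀.galoisFunctionField_algebraMap σ)

end Galois

/-- The group of `k`-rational points of the Jacobian (`k` perfect): the divisor classes of degree
zero on the curve over the algebraic closure of `k` that are fixed by the absolute Galois group
of `k`. -/
def jacobianPoints [PerfectField k] :
    AddSubgroup (PicardGroup (AlgebraicClosure k)
      (X₀.baseChange (AlgebraicClosure k)).FunctionField) :=
  picardZero _ _ ⊓
    ⨅ σ : AlgebraicClosure k ≃ₐ[k] AlgebraicClosure k,
      (X₀.galoisPicard σ).eqLocus (AddMonoidHom.id _)

end GenusTwoCurve

/-! ### The family `d y² = x⁶ + c₄ x⁴ + c₂ x² + c₀` and the elliptic curve parametrizing it -/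

namespace Family

def c₄ (s : ℚ) : ℚ := -31 * (s ^ 4 + 42 * s ^ 2 - (32200 / 93) * s - 147)

def c₂ (s : ℚ) : ℚ :=
  2 ^ 8 * (s ^ 8 + 84 * s ^ 6 - (3472 / 3) * s ^ 5 + 1470 * s ^ 4 - 48608 * s ^ 3
    + 53508 * s ^ 2 + 170128 * s + 21609)

def c₀ (s : ℚ) : ℚ := (2 ^ 20 * 7 / 3) * s * (s ^ 2 + 7) ^ 3 * (s ^ 2 + 63)

def d (s : ℚ) : ℚ := s ^ 4 + 42 * s ^ 2 + (1736 / 3) * s - 147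

/-- `X₀` is the genus-two curve `d y² = x⁶ + c₄ x⁴ + c₂ x² + c₀` with parameter `s`. -/
def IsMember (s : ℚ) (X₀ : GenusTwoCurve ℚ) : Prop :=
  c₀ s * d s ≠ 0 ∧ X₀.a = d s ∧ X₀.h = 0 ∧
    X₀.f = X ^ 6 + C (c₄ s) * X ^ 4 + C (c₂ s) * X ^ 2 + C (c₀ s)

/-- The elliptic curve `y² = x³ + 14 x² + 196 x`. -/
def D : WeierstrassCurve ℚ := ⟨0, 14, 0, 196, 0⟩

/-- The parameter `s` arises from the point `(z, w)` of `D(ℚ)`. -/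
def ArisesFrom (s z w : ℚ) : Prop :=
  D.toAffine.Nonsingular z w ∧
    z ^ 4 - 896 * z ^ 3 - 24696 * z ^ 2 - 175616 * z + 38416 ≠ 0 ∧
    s = -21 * (((z ^ 2 + 196) * (z ^ 2 + 56 * z + 196) + 32 * (z + 14) * (z - 14) * w)
      / (z ^ 4 - 896 * z ^ 3 - 24696 * z ^ 2 - 175616 * z + 38416))

end Family

/-- The right-hand sides of the three curves `y² + (x² + x) y = f(x)`. -/
def sextic : Fin 3 → ℚ[X] :=
  ![X ^ 6 - 3 * X ^ 5 - 5 * X ^ 4 + 14 * X ^ 3 + 8 * X ^ 2 - 16 * X,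
    X ^ 6 - X ^ 5 + 5 * X ^ 4 - 11 * X ^ 3 + 10 * X ^ 2 - 6 * X + 2,
    1217 * X ^ 6 - 3651 * X ^ 5 + 15717859 * X ^ 4 - 31429634 * X ^ 3
      + 60403483004 * X ^ 2 - 60387768796 * X + 80875050306064]

/-- The parameters of the corresponding members of the family. -/
def parameter : Fin 3 → ℚ := ![-21, 3, 21 / 31]

/-- The points of `D(ℚ)` from which the parameters arise. -/
def pointOfD : Fin 3 → ℚ × ℚ := ![(0, 0), (7, -49), (16, -104)]

end

/-! Everything is done with explicit functions on a hyperelliptic curve `w² = G(x)`, `G` a separable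
sextic, without Riemann-Roch. A Mumford pair `(u, v)` with `u` monic quadratic, `u ∣ v² - G` and `u`
coprime to `v` is an effective divisor of degree two free of Weierstrass points. Subtracting a fibre
of `x` gives a divisor of degree zero. If `u`, `v` and the fibre are rational, this divisor is
itself Galois-stable, so it defines a rational point of the Jacobian.

Two functions produce all the relations. If `V² - G = κ u₁ u₂ u₃` and `V ≡ vᵢ mod uᵢ`, then `(w -
V(x)) / (x - c)³` shows that the three classes sum to zero (`point_add_point_add_point`); and `u(x)
/ (x - c)²` shows that `(u, -v)` is the negative of `(u, v)` (`point_add_conj`). Nonvanishing comes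
from one principle (`ord_ne_mul_mumfordOrd_sub`): if `m ≤ 2` times a class were zero, clearing the
fibre would give a function without affine poles and with poles at infinity at most `m` times those
of `x`. Since `w` has three times the poles of `x`, this function is a polynomial in `x`, hence
takes the same value at conjugate points, whereas it must vanish at a point of `(u, v)` and not at
its conjugate.

For each curve, explicit cubics give classes `a₂ = -2a₁`, `a₄ = -4a₁`, `a₆ = -6a₁` and `16a₁ = 0`,
and a class `b` with `3b = 0`. The principle gives `2a₄ = -8a₁ ≠ 0` and `b ≠ 0`, so `a₁ + b` has
order `48`.

The sextics used for the relations are cubics in `t = X² - X`, that is, invariant under `X ↦ 1 - X`.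
Hence `a₂`, `a₄`, `a₆` are pulled back from points of the elliptic curve `w² = g(t)`, where the
relations are chords and tangents, and `b` comes from the complementary quotient. Moving the centre
`1/2` to `0` makes the sextic even; this is the isomorphism with the member of the family. -/

noncomputable section

/-! ### Function fields of the form `K(x, √G(x))` -/

/-- The field `F` is generated over `K` by a transcendental element `x` and a square root `y` of
`G(x)`. -/
structure IsModel {K F : Type*} [Field K] [Field F] [Algebra K F] (G : K[X]) (x y : F) : Prop where
  transcendental : Transcendental K x
  sq_eq : y ^ 2 = aeval x G
  adjoin_eq_top : IntermediateField.adjoin K {x, y} = ⊤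

namespace IsModel

variable {K F F' : Type*} [Field K] [Field F] [Algebra K F] [Field F'] [Algebra K F']
  {G : K[X]} {x y : F} {x' y' : F'}

theorem aeval_injective (h : IsModel G x y) : Function.Injective (aeval x : K[X] →ₐ[K] F) :=
  transcendental_iff_injective.1 h.transcendental

theorem aeval_ne_zero (h : IsModel G x y) {p : K[X]} (hp : p ≠ 0) : aeval x p ≠ 0 :=
  (map_ne_zero_iff _ h.aeval_injective).2 hp

theorem neg (h : IsModel G x y) : IsModel G x (-y) where
  transcendental := h.transcendental
  sq_eq := by rw [neg_sq, h.sq_eq]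
  adjoin_eq_top := by
    rw [eq_top_iff, ← h.adjoin_eq_top, IntermediateField.adjoin_le_iff]
    have h1 : x ∈ IntermediateField.adjoin K {x, -y} := IntermediateField.subset_adjoin _ _ (by simp)
    have h2 : -y ∈ IntermediateField.adjoin K {x, -y} :=
      IntermediateField.subset_adjoin _ _ (by simp)
    rintro z (rfl | rfl)
    · exact h1
    · simpa using neg_mem h2

/-- Changing the generators of the function field. -/
theorem change {G₂ : K[X]} {x₂ y₂ : F} (h : IsModel G x y) (hsq : y₂ ^ 2 = aeval x₂ G₂)
    (hx : x ∈ IntermediateField.adjoin K {x₂})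
    (hy : y ∈ IntermediateField.adjoin K {x₂, y₂}) : IsModel G₂ x₂ y₂ where
  -- If `x₂` were algebraic over `K`, so would be all of `K(x₂)`, which contains `x`.
  transcendental := fun ha => h.transcendental <| by
    have : Algebra.IsAlgebraic K (IntermediateField.adjoin K {x₂}) :=
      IntermediateField.isAlgebraic_adjoin_simple ha.isIntegral
    have h1 : IsAlgebraic K (⟨x, hx⟩ : IntermediateField.adjoin K {x₂}) :=
      Algebra.IsAlgebraic.isAlgebraic _
    simpa using h1.algHom (IntermediateField.val _)
  sq_eq := hsq
  adjoin_eq_top := by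
    rw [eq_top_iff, ← h.adjoin_eq_top, IntermediateField.adjoin_le_iff]
    rintro z (rfl | rfl)
    · exact IntermediateField.adjoin.mono K _ _ (by simp) hx
    · exact hy

/-- Otherwise `a² = b² G` makes `G` the square of `a / b`, which is a polynomial because `K[X]` is
integrally closed; a nonconstant squarefree `G` is not a square. This is the independence of `1` and
`y` over `K(x)`. -/
theorem eq_zero_of_add_mul_eq_zero (h : IsModel G x y) (hG : Squarefree G) (hd : 0 < G.natDegree)
    {a b : K[X]} (hab : aeval x a + aeval x b * y = 0) : a = 0 ∧ b = 0 := by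
  have key : a ^ 2 = b ^ 2 * G := by
    apply h.aeval_injective
    simp only [map_mul, map_pow, ← h.sq_eq]
    linear_combination (aeval x a - aeval x b * y) * hab
  by_cases hb : b = 0
  · subst hb
    exact ⟨by simpa using key, rfl⟩
  · exfalso
    obtain ⟨e, rfl⟩ := (IsIntegrallyClosed.pow_dvd_pow_iff two_ne_zero).1 (Dvd.intro _ key.symm)
    have he : e * e = G := by
      apply mul_left_cancel₀ (pow_ne_zero 2 hb)
      linear_combination key
    have hu : IsUnit e := hG e (by rw [he])
    rw [← he, natDegree_eq_zero_of_isUnit (hu.mul hu)] at hd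
    exact hd.false

theorem sq_sub_ne_zero (h : IsModel G x y) (hG : Squarefree G) (hd : 0 < G.natDegree)
    {a b : K[X]} (hab : ¬ (a = 0 ∧ b = 0)) : a ^ 2 - b ^ 2 * G ≠ 0 := by
  intro h0
  have h1 : (aeval x a + aeval x b * y) * (aeval x a + aeval x (-b) * y) = 0 := by
    have := congrArg (aeval x) h0
    simp only [map_sub, map_mul, map_pow, map_zero, ← h.sq_eq, map_neg] at this ⊢
    linear_combination this
  rcases mul_eq_zero.1 h1 with h2 | h2
  · exact hab (h.eq_zero_of_add_mul_eq_zero hG hd h2)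
  · exact hab (by simpa using h.eq_zero_of_add_mul_eq_zero hG hd h2)

/-- The elements `(a + b y) / c` form a field: inverses come from the norm `a² - b² G`, which is
nonzero by `sq_sub_ne_zero`. -/
theorem exists_repr (h : IsModel G x y) (hG : Squarefree G) (hd : 0 < G.natDegree) (z : F) :
    ∃ a b c : K[X], c ≠ 0 ∧ aeval x c * z = aeval x a + aeval x b * y := by
  have hz : z ∈ IntermediateField.adjoin K {x, y} := by rw [h.adjoin_eq_top]; trivial
  induction hz using IntermediateField.adjoin_induction with
  | mem z hz =>
    rcases hz with rfl | rfl
    · exact ⟨X, 0, 1, one_ne_zero, by simp⟩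
    · exact ⟨0, 1, 1, one_ne_zero, by simp⟩
  | algebraMap r => exact ⟨C r, 0, 1, one_ne_zero, by simp⟩
  | add z w _ _ hz hw =>
    obtain ⟨a, b, c, hc, hz⟩ := hz
    obtain ⟨a', b', c', hc', hw⟩ := hw
    refine ⟨a * c' + a' * c, b * c' + b' * c, c * c', mul_ne_zero hc hc', ?_⟩
    simp only [map_add, map_mul]
    linear_combination aeval x c' * hz + aeval x c * hw
  | inv z _ hz =>
    obtain ⟨a, b, c, hc, hz⟩ := hz
    by_cases h0 : z = 0
    · exact ⟨0, 0, 1, one_ne_zero, by simp [h0]⟩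
    have hab : ¬ (a = 0 ∧ b = 0) := by
      rintro ⟨rfl, rfl⟩
      exact mul_ne_zero (h.aeval_ne_zero hc) h0 (by simpa using hz)
    refine ⟨c * a, -(c * b), _, h.sq_sub_ne_zero hG hd hab, ?_⟩
    simp only [map_sub, map_mul, map_pow, map_neg, ← h.sq_eq]
    rw [← div_eq_mul_inv, div_eq_iff h0]
    linear_combination -(aeval x a - aeval x b * y) * hz
  | mul z w _ _ hz hw =>
    obtain ⟨a, b, c, hc, hz⟩ := hz
    obtain ⟨a', b', c', hc', hw⟩ := hw
    refine ⟨a * a' + b * b' * G, a * b' + a' * b, c * c', mul_ne_zero hc hc', ?_⟩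
    simp only [map_add, map_mul, ← h.sq_eq]
    linear_combination aeval x c' * w * hz + (aeval x a + aeval x b * y) * hw

/-- The homomorphism to `F` from the coordinate ring of `y² = G(x)`. -/
def hom (h : IsModel G x y) : AdjoinRoot (X ^ 2 - C G : K[X][X]) →ₐ[K] F :=
  AdjoinRoot.liftAlgHom _ (aeval x) y (by simp [h.sq_eq])

theorem hom_root (h : IsModel G x y) : h.hom (AdjoinRoot.root _) = y := by
  simp [hom]

theorem hom_of (h : IsModel G x y) (p : K[X]) : h.hom (AdjoinRoot.of _ p) = aeval x p := by
  simp [hom]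

/-- Division by the monic `Y² - G` leaves a remainder `a + b Y`, so independence of `1` and `y`
gives injectivity and `exists_repr` gives the fractions. -/
theorem isFractionRing (h : IsModel G x y) (hG : Squarefree G) (hd : 0 < G.natDegree) :
    letI := h.hom.toRingHom.toAlgebra
    IsFractionRing (AdjoinRoot (X ^ 2 - C G : K[X][X])) F := by
  let _ := h.hom.toRingHom.toAlgebra
  have hinj : Function.Injective h.hom := by
    rw [injective_iff_map_eq_zero]
    intro r hr
    obtain ⟨p, rfl⟩ := AdjoinRoot.mk_surjective r
    have hm : (X ^ 2 - C G : K[X][X]).Monic := by monicity!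
    have hdeg : (X ^ 2 - C G : K[X][X]).natDegree = 2 := by compute_degree!
    have hlt : (p %ₘ (X ^ 2 - C G)).natDegree ≤ 1 := by
      have := natDegree_modByMonic_lt p hm (by intro h1; rw [h1] at hdeg; simp at hdeg)
      omega
    obtain ⟨b, a, hab⟩ := exists_eq_X_add_C_of_natDegree_le_one hlt
    have hp : AdjoinRoot.mk (X ^ 2 - C G) p = AdjoinRoot.of _ b * AdjoinRoot.root _
        + AdjoinRoot.of _ a := by
      conv_lhs => rw [← modByMonic_add_div p (X ^ 2 - C G), hab]
      simp
    rw [hp] at hr ⊢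
    rw [map_add, map_mul, hom_of, hom_of, hom_root] at hr
    obtain ⟨rfl, rfl⟩ := h.eq_zero_of_add_mul_eq_zero hG hd (a := a) (b := b) (by rw [← hr]; ring)
    simp
  have : FaithfulSMul (AdjoinRoot (X ^ 2 - C G : K[X][X])) F :=
    (faithfulSMul_iff_algebraMap_injective _ _).2 hinj
  refine IsFractionRing.of_field _ _ fun z => ?_
  obtain ⟨a, b, c, hc, hz⟩ := h.exists_repr hG hd z
  refine ⟨AdjoinRoot.of _ a + AdjoinRoot.of _ b * AdjoinRoot.root _, AdjoinRoot.of _ c, ?_⟩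
  change z = h.hom _ / h.hom _
  rw [map_add, map_mul, hom_of, hom_of, hom_of, hom_root, eq_div_iff (h.aeval_ne_zero hc), ← hz,
    mul_comm]

/-- Two fields with models given by the same polynomial are isomorphic. -/
theorem exists_algEquiv (h : IsModel G x y) (h' : IsModel G x' y') (hG : Squarefree G)
    (hd : 0 < G.natDegree) : ∃ e : F ≃ₐ[K] F', e x = x' ∧ e y = y' := by
  let _ := h.hom.toRingHom.toAlgebra
  let _ := h'.hom.toRingHom.toAlgebra
  have := h.isFractionRing hG hd
  have := h'.isFractionRing hG hd
  have : IsScalarTower K (AdjoinRoot (X ^ 2 - C G : K[X][X])) F :=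
    IsScalarTower.of_algebraMap_eq fun c => (h.hom.commutes c).symm
  have : IsScalarTower K (AdjoinRoot (X ^ 2 - C G : K[X][X])) F' :=
    IsScalarTower.of_algebraMap_eq fun c => (h'.hom.commutes c).symm
  let e : F ≃ₐ[AdjoinRoot (X ^ 2 - C G : K[X][X])] F' :=
    IsLocalization.algEquiv (nonZeroDivisors (AdjoinRoot (X ^ 2 - C G : K[X][X]))) F F'
  have he : ∀ r, e (h.hom r) = h'.hom r := fun r => e.commutes r
  refine ⟨e.restrictScalars K, ?_, ?_⟩
  · have := he (AdjoinRoot.of _ X)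
    rwa [hom_of, hom_of, aeval_X, aeval_X] at this
  · have := he (AdjoinRoot.root _)
    rwa [hom_root, hom_root] at this

end IsModel

/-! ### Places and integral closures -/

section Dedekind

variable {K F : Type*} [Field K] [Field F] [Algebra K F]

open scoped IntermediateField.algebraAdjoinAdjoin

theorem isPrincipalIdealRing_adjoin_singleton (t : F) :
    IsPrincipalIdealRing (Algebra.adjoin K {t}) := by
  have hs : Function.Surjective ((aeval t : K[X] →ₐ[K] F).codRestrict (Algebra.adjoin K {t})
      (fun p => aeval_mem_adjoin_singleton K t)) := by
    rintro ⟨z, hz⟩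
    rw [Algebra.adjoin_singleton_eq_range_aeval] at hz
    obtain ⟨p, rfl⟩ := hz
    exact ⟨p, rfl⟩
  exact IsPrincipalIdealRing.of_surjective _ hs

/-- The place given by a maximal ideal of a Dedekind domain containing the constants. -/
def Place.ofHeightOneSpectrum {C : Type*} [CommRing C] [IsDedekindDomain C] [Algebra K C]
    [Algebra C F] [IsFractionRing C F] [IsScalarTower K C F]
    (v : IsDedekindDomain.HeightOneSpectrum C) : Place K F where
  v := v.valuation F
  surjective := v.valuation_surjective F
  trivial c hc := by
    have h1 : v.valuation F (algebraMap K F c) ≤ 1 := by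
      rw [IsScalarTower.algebraMap_apply K C F]
      exact v.valuation_le_one _
    have h2 : v.valuation F (algebraMap K F c⁻¹) ≤ 1 := by
      rw [IsScalarTower.algebraMap_apply K C F]
      exact v.valuation_le_one _
    refine le_antisymm h1 ?_
    rw [map_inv₀, map_inv₀] at h2
    have h0 : v.valuation F (algebraMap K F c) ≠ 0 := by
      rw [Valuation.ne_zero_iff]
      simpa using hc
    exact (inv_le_one₀ (zero_lt_iff.2 h0)).1 h2

/-- A function that is regular at all the places where `t` is regular is integral over `K[t]`. -/
theorem isIntegral_of_forall_place [CharZero K] (t : F)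
    [FiniteDimensional (IntermediateField.adjoin K {t}) F] (f : F)
    (hf : ∀ P : Place K F, P.v t ≤ 1 → P.v f ≤ 1) : IsIntegral (Algebra.adjoin K {t}) f := by
  have := isPrincipalIdealRing_adjoin_singleton (K := K) t
  have : CharZero (IntermediateField.adjoin K {t}) := algebraRat.charZero _
  -- Characteristic zero makes `F / K(t)` separable, so the integral closure of the principal ideal
  -- domain `K[t]` in `F` is Dedekind with fraction field `F`.
  have : IsFractionRing (integralClosure (Algebra.adjoin K {t}) F) F :=
    integralClosure.isFractionRing_of_finite_extension (IntermediateField.adjoin K {t}) F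
  have : IsDedekindDomain (integralClosure (Algebra.adjoin K {t}) F) :=
    integralClosure.isDedekindDomain _ (IntermediateField.adjoin K {t}) F
  have : IsScalarTower K (integralClosure (Algebra.adjoin K {t}) F) F :=
    IsScalarTower.of_algebraMap_eq fun c => rfl
  -- Each maximal ideal of the integral closure is a place at which `t` is regular, since `t` lies
  -- in that ring; an element integral at all these primes belongs to the ring.
  obtain ⟨g, hg⟩ := IsDedekindDomain.HeightOneSpectrum.mem_integers_of_valuation_le_one
    (R := integralClosure (Algebra.adjoin K {t}) F) F f fun v =>
      hf (Place.ofHeightOneSpectrum v) (v.valuation_le_one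
        (algebraMap (Algebra.adjoin K {t}) (integralClosure (Algebra.adjoin K {t}) F)
          ⟨t, Algebra.self_mem_adjoin_singleton K t⟩))
  rw [← hg]
  exact g.2

/-- A rational function of `t` that is integral over `K[t]` is a polynomial in `t`. -/
theorem exists_aeval_eq_of_isIntegral {t f : F}
    (hf : f ∈ IntermediateField.adjoin K {t}) (hi : IsIntegral (Algebra.adjoin K {t}) f) :
    ∃ p : K[X], f = aeval t p := by
  have := isPrincipalIdealRing_adjoin_singleton (K := K) t
  have h1 : IsIntegral (Algebra.adjoin K {t}) (⟨f, hf⟩ : IntermediateField.adjoin K {t}) := by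
    refine (isIntegral_algHom_iff (IsScalarTower.toAlgHom (Algebra.adjoin K {t})
      (IntermediateField.adjoin K {t}) F) ?_).1 hi
    exact Subtype.val_injective
  obtain ⟨⟨g, hg⟩, hgf⟩ := IsIntegrallyClosed.isIntegral_iff.1 h1
  rw [Algebra.adjoin_singleton_eq_range_aeval] at hg
  obtain ⟨p, rfl⟩ := hg
  exact ⟨p, (congrArg Subtype.val hgf).symm⟩

end Dedekind

/-- After division by the gcd, the remaining factor of `c` is coprime to that of `b`, so its square
divides `G` and it is a unit. -/
theorem Polynomial.dvd_of_sq_dvd_sq_mul_squarefree {K : Type*} [Field K] {b c G : K[X]}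
    (hG : Squarefree G) (hc : c ≠ 0) (h : c ^ 2 ∣ b ^ 2 * G) : c ∣ b := by
  classical
  obtain ⟨b', hb⟩ := EuclideanDomain.gcd_dvd_left b c
  obtain ⟨c', hc'⟩ := EuclideanDomain.gcd_dvd_right b c
  have h1 := EuclideanDomain.gcd_eq_gcd_ab b c
  generalize EuclideanDomain.gcd b c = g at hb hc' h1
  have hg : g ≠ 0 := fun h0 => hc (by rw [hc', h0, zero_mul])
  have hcop : IsCoprime b' c' := by
    refine ⟨EuclideanDomain.gcdA b c, EuclideanDomain.gcdB b c, mul_left_cancel₀ hg ?_⟩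
    linear_combination -h1 - EuclideanDomain.gcdA b c * hb - EuclideanDomain.gcdB b c * hc'
  have h2 : c' ^ 2 ∣ b' ^ 2 * G := by
    rw [hc', hb, mul_pow, mul_pow, mul_assoc] at h
    exact (mul_dvd_mul_iff_left (pow_ne_zero 2 hg)).1 h
  have h3 : IsUnit c' := hG c' (by rw [← pow_two]; exact hcop.symm.pow.dvd_of_dvd_mul_left h2)
  rw [hc', hb]
  exact mul_dvd_mul_left _ h3.dvd

/-! ### Functions without poles on the affine curve -/

namespace IsModel

variable {K F : Type*} [Field K] [Field F] [Algebra K F] {G : K[X]} {x y : F}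

theorem finiteDimensional (h : IsModel G x y) :
    FiniteDimensional (IntermediateField.adjoin K {x}) F := by
  have hy : IsIntegral (IntermediateField.adjoin K {x}) y := by
    refine IsIntegral.of_pow two_pos ?_
    rw [h.sq_eq]
    have hx : aeval x G ∈ IntermediateField.adjoin K {x} :=
      IntermediateField.algebra_adjoin_le_adjoin _ _ (aeval_mem_adjoin_singleton K x)
    exact isIntegral_algebraMap (R := IntermediateField.adjoin K {x}) (x := ⟨_, hx⟩)
  have htop : IntermediateField.adjoin (IntermediateField.adjoin K {x}) {y} = ⊤ := by
    apply IntermediateField.restrictScalars_injective K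
    rw [IntermediateField.adjoin_adjoin_left, IntermediateField.restrictScalars_top,
      ← h.adjoin_eq_top]
    rfl
  have := IntermediateField.adjoin.finiteDimensional hy
  rw [htop] at this
  exact IntermediateField.topEquiv.toLinearEquiv.finiteDimensional

/-- The hyperelliptic involution: `(x, -y)` is a second model with the same `G`. -/
theorem exists_involution (h : IsModel G x y) (hG : Squarefree G) (hd : 0 < G.natDegree) :
    ∃ τ : F ≃ₐ[K] F, τ x = x ∧ τ y = -y :=
  h.exists_algEquiv h.neg hG hd

/-- This says that `K[x, y]` is integrally closed, because `G` is squarefree. For `f = (a + b y) /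
c` integral over `K[x]`, the trace `f + τ f` and the square `(f - τ f)² = 4 b² G / c²` are integral
elements of `K(x)`, hence polynomials; the second forces `c ∣ b`. -/
theorem exists_eq_of_forall_place [CharZero K] (h : IsModel G x y) (hG : Squarefree G)
    (hd : 0 < G.natDegree) (f : F) (hf : ∀ P : Place K F, P.v x ≤ 1 → P.v f ≤ 1) :
    ∃ a b : K[X], f = aeval x a + aeval x b * y := by
  have := h.finiteDimensional
  have hfi := isIntegral_of_forall_place x f hf
  obtain ⟨τ, hx, hy⟩ := h.exists_involution hG hd
  have hp : ∀ p : K[X], τ (aeval x p) = aeval x p := fun p => by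
    rw [← aeval_algHom_apply, hx]
  have hfi' : IsIntegral (Algebra.adjoin K {x}) (τ f) := by
    obtain ⟨m, hm, hm0⟩ := hfi
    refine ⟨m, hm, ?_⟩
    have h1 : (τ : F →+* F).comp (algebraMap (Algebra.adjoin K {x}) F)
        = algebraMap (Algebra.adjoin K {x}) F := by
      ext ⟨z, hz⟩
      rw [Algebra.adjoin_singleton_eq_range_aeval] at hz
      obtain ⟨p, rfl⟩ := hz
      exact hp p
    have h2 := hom_eval₂ m (algebraMap (Algebra.adjoin K {x}) F) (τ : F →+* F) f
    rw [hm0, map_zero, h1] at h2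
    exact h2.symm
  obtain ⟨a, b, c, hc, hz⟩ := h.exists_repr hG hd f
  have hcx := h.aeval_ne_zero hc
  have hz' : aeval x c * τ f = aeval x a - aeval x b * y := by
    have := congrArg τ hz
    rw [map_mul, map_add, map_mul, hp, hp, hp, hy] at this
    rw [this]; ring
  have hmem : ∀ p : K[X], aeval x p ∈ IntermediateField.adjoin K {x} := fun p =>
    IntermediateField.algebra_adjoin_le_adjoin _ _ (aeval_mem_adjoin_singleton K x)
  obtain ⟨r, hr⟩ := exists_aeval_eq_of_isIntegral (f := f + τ f) (by
    have : f + τ f = 2 * aeval x a / aeval x c := by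
      rw [eq_div_iff hcx]; linear_combination hz + hz'
    rw [this]
    exact div_mem (mul_mem (ofNat_mem _ 2) (hmem _)) (hmem _)) (hfi.add hfi')
  obtain ⟨s, hs⟩ := exists_aeval_eq_of_isIntegral (f := (f - τ f) ^ 2) (by
    have : (f - τ f) ^ 2 = aeval x (4 * b ^ 2 * G) / aeval x (c ^ 2) := by
      rw [eq_div_iff (by rw [map_pow]; exact pow_ne_zero 2 hcx)]
      simp only [map_mul, map_pow, ← h.sq_eq, map_ofNat]
      have h1 : aeval x c * (f - τ f) = 2 * (aeval x b * y) := by linear_combination hz - hz'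
      linear_combination (aeval x c * (f - τ f) + 2 * (aeval x b * y)) * h1
    rw [this]
    exact div_mem (hmem _) (hmem _)) ((hfi.sub hfi').pow 2)
  obtain ⟨e, rfl⟩ : c ∣ b := by
    have h4 : c ∣ 2 * b := by
      apply dvd_of_sq_dvd_sq_mul_squarefree hG hc
      refine ⟨s, h.aeval_injective ?_⟩
      simp only [map_mul, map_pow, ← h.sq_eq, map_ofNat, ← hs]
      have h1 : aeval x c * (f - τ f) = 2 * (aeval x b * y) := by linear_combination hz - hz'
      linear_combination -(aeval x c * (f - τ f) + 2 * (aeval x b * y)) * h1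
    have h2 : IsUnit (2 : K[X]) := by
      rw [← map_ofNat C 2]
      exact isUnit_C.2 (isUnit_iff_ne_zero.2 two_ne_zero)
    exact h2.dvd_mul_left.1 h4
  refine ⟨C (1 / 2) * r, e, ?_⟩
  have h1 : f - τ f = 2 * (aeval x e * y) := by
    apply mul_left_cancel₀ hcx
    rw [map_mul] at hz hz'
    linear_combination hz - hz'
  have h2 : (algebraMap K F (1 / 2)) * 2 = 1 := by
    rw [← map_ofNat (algebraMap K F) 2, ← map_mul]
    norm_num
  rw [map_mul, ← hr, aeval_C]
  linear_combination algebraMap K F (1 / 2) * h1 + (aeval x e * y - f) * h2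

/-- Without poles, `x` would be integral over `K[x⁻¹]`, hence a polynomial `p(x⁻¹)`; evaluating `X p
= 1` at `0` is absurd. -/
theorem exists_place_one_lt [CharZero K] (h : IsModel G x y) : ∃ P : Place K F, 1 < P.v x := by
  by_contra! hall
  have hx0 : x ≠ 0 := by
    rintro rfl
    exact h.transcendental isAlgebraic_zero
  have hadj : IntermediateField.adjoin K {x⁻¹} = IntermediateField.adjoin K {x} := by
    apply le_antisymm <;> rw [IntermediateField.adjoin_simple_le_iff]
    · exact inv_mem (IntermediateField.mem_adjoin_simple_self K x)
    · simpa using inv_mem (IntermediateField.mem_adjoin_simple_self K x⁻¹)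
  have : FiniteDimensional (IntermediateField.adjoin K {x⁻¹}) F := by
    rw [hadj]; exact h.finiteDimensional
  have ht : Transcendental K x⁻¹ := fun ha => h.transcendental (by simpa using ha.inv)
  obtain ⟨p, hp⟩ := exists_aeval_eq_of_isIntegral
    (by rw [hadj]; exact IntermediateField.mem_adjoin_simple_self K x)
    (isIntegral_of_forall_place x⁻¹ x fun P _ => hall P)
  have h1 : aeval x⁻¹ (X * p) = aeval x⁻¹ (1 : K[X]) := by
    rw [map_mul, aeval_X, ← hp, map_one, inv_mul_cancel₀ hx0]
  have h2 := transcendental_iff_injective.1 ht h1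
  have h3 := congrArg (eval 0) h2
  simp at h3

end IsModel

/-! ### Valuation calculus at a place -/

namespace Place

variable {K F : Type*} [Field K] [Field F] [Algebra K F] (P : Place K F) {f g x y : F}

instance : P.v.IsTrivialOn K where
  eq_one c hc := P.trivial c hc

theorem v_ne_zero (hf : f ≠ 0) : P.v f ≠ 0 := (Valuation.ne_zero_iff _).2 hf

theorem v_algebraMap_le_one (c : K) : P.v (algebraMap K F c) ≤ 1 := by
  by_cases hc : c = 0
  · simp [hc]
  · exact (P.trivial c hc).le

theorem v_ofNat [CharZero K] (n : ℕ) [n.AtLeastTwo] : P.v (OfNat.ofNat n : F) = 1 := by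
  rw [← map_ofNat (algebraMap K F) n]
  exact P.trivial _ (OfNat.ofNat_ne_zero n)

theorem v_aeval_le_one (hx : P.v x ≤ 1) (p : K[X]) : P.v (aeval x p) ≤ 1 := by
  induction p using Polynomial.induction_on' with
  | add p q hp hq => rw [map_add]; exact P.v.map_add_le hp hq
  | monomial n a =>
    rw [aeval_monomial, map_mul, map_pow]
    exact mul_le_one' (P.v_algebraMap_le_one a) (pow_le_one' hx n)

theorem v_aeval_of_one_lt (hx : 1 < P.v x) {p : K[X]} (hp : p ≠ 0) :
    P.v (aeval x p) = P.v x ^ p.natDegree :=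
  valuation_aeval_eq_valuation_X_pow_natDegree_of_one_lt_valuation_X x hx hp

theorem v_aeval_le_of_one_lt (hx : 1 < P.v x) {p : K[X]} {n : ℕ} (hp : p.natDegree ≤ n) :
    P.v (aeval x p) ≤ P.v x ^ n := by
  by_cases h0 : p = 0
  · simp [h0]
  · rw [P.v_aeval_of_one_lt hx h0]
    exact pow_le_pow_right₀ hx.le hp

theorem v_sub_algebraMap_of_one_lt (hx : 1 < P.v x) (c : K) :
    P.v (x - algebraMap K F c) = P.v x := by
  simpa using P.v_aeval_of_one_lt hx (X_sub_C_ne_zero c)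

theorem v_le_one_of_sub_lt {α : K} (hx : P.v (x - algebraMap K F α) < 1) : P.v x ≤ 1 := by
  have := P.v.map_add_le hx.le (P.v_algebraMap_le_one α)
  rwa [sub_add_cancel] at this

theorem v_aeval_sub_lt_one {α : K} (hx : P.v (x - algebraMap K F α) < 1) (p : K[X]) :
    P.v (aeval x p - algebraMap K F (p.eval α)) < 1 := by
  obtain ⟨q, hq⟩ := X_sub_C_dvd_sub_C_eval (a := α) (p := p)
  have h1 := congrArg (aeval x) hq
  simp only [map_sub, map_mul, aeval_X, aeval_C] at h1
  rw [h1, map_mul]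
  exact mul_lt_one_of_lt_of_le hx (P.v_aeval_le_one (P.v_le_one_of_sub_lt hx) q)

theorem v_lt_one_iff_of_sub_lt (h : P.v (f - g) < 1) : P.v f < 1 ↔ P.v g < 1 := by
  constructor <;> intro h1
  · have := P.v.map_sub_lt h1 h
    rwa [sub_sub_cancel] at this
  · have := P.v.map_add_lt h1 h
    rwa [add_sub_cancel] at this

theorem v_algebraMap_lt_one_iff (c : K) : P.v (algebraMap K F c) < 1 ↔ c = 0 := by
  refine ⟨fun h => by_contra fun hc => h.ne (P.trivial c hc), ?_⟩
  rintro rfl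
  simp

theorem v_aeval_lt_one_iff {α : K} (hx : P.v (x - algebraMap K F α) < 1) (p : K[X]) :
    P.v (aeval x p) < 1 ↔ p.eval α = 0 := by
  rw [P.v_lt_one_iff_of_sub_lt (P.v_aeval_sub_lt_one hx p), P.v_algebraMap_lt_one_iff]

theorem ord_mul (hf : f ≠ 0) (hg : g ≠ 0) : P.ord (f * g) = P.ord f + P.ord g := by
  rw [ord, ord, ord, map_mul, WithZero.log_mul (P.v_ne_zero hf) (P.v_ne_zero hg)]
  ring

theorem ord_inv : P.ord f⁻¹ = -P.ord f := by
  rw [ord, ord, map_inv₀, WithZero.log_inv]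

theorem ord_pow (n : ℕ) : P.ord (f ^ n) = n * P.ord f := by
  rw [ord, ord, map_pow, WithZero.log_pow]
  simp

theorem ord_div (hf : f ≠ 0) (hg : g ≠ 0) : P.ord (f / g) = P.ord f - P.ord g := by
  rw [div_eq_mul_inv, P.ord_mul hf (inv_ne_zero hg), ord_inv, sub_eq_add_neg]

theorem ord_eq_zero_of_v_eq_one (h : P.v f = 1) : P.ord f = 0 := by
  simp [ord, h]

theorem ord_congr (h : P.v f = P.v g) : P.ord f = P.ord g := by
  rw [ord, ord, h]

theorem v_eq_exp (hf : f ≠ 0) : P.v f = WithZero.exp (-P.ord f) := by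
  rw [ord, neg_neg, WithZero.exp_log (P.v_ne_zero hf)]

theorem v_le_one_iff (hf : f ≠ 0) : P.v f ≤ 1 ↔ 0 ≤ P.ord f := by
  rw [P.v_eq_exp hf, ← WithZero.exp_zero, WithZero.exp_le_exp]
  omega

theorem v_lt_one_iff (hf : f ≠ 0) : P.v f < 1 ↔ 0 < P.ord f := by
  rw [P.v_eq_exp hf, ← WithZero.exp_zero, WithZero.exp_lt_exp]
  omega

/-- The place lies over the point `(α, β)` of the affine plane. -/
def IsAt (x y : F) (α β : K) : Prop :=
  P.v (x - algebraMap K F α) < 1 ∧ P.v (y - algebraMap K F β) < 1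

end Place

/-! ### Points of the affine curve and their uniformizers -/

namespace IsModel

variable {K F : Type*} [Field K] [Field F] [Algebra K F] {G : K[X]} {x y : F} {α β : K}

theorem sub_algebraMap_ne_zero (h : IsModel G x y) (α : K) : x - algebraMap K F α ≠ 0 := by
  simpa using h.aeval_ne_zero (X_sub_C_ne_zero α)

theorem v_y_le_one (h : IsModel G x y) {P : Place K F} (hx : P.v x ≤ 1) : P.v y ≤ 1 := by
  have h1 : P.v y ^ 2 ≤ 1 := by
    rw [← map_pow, h.sq_eq]
    exact P.v_aeval_le_one hx G
  by_contra! h2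
  exact (one_lt_pow₀ h2 two_ne_zero).not_ge h1

variable [CharZero K]

/-- If no place lay over `(α, β)`, the function `(y + β) / (x - α)` would have no affine poles,
hence be `a + b y`; comparing coefficients of `y` gives `b (X - α) = 1`. -/
theorem exists_isAt (h : IsModel G x y) (hG : Squarefree G) (hd : 0 < G.natDegree)
    (hβ : β ^ 2 = G.eval α) : ∃ P : Place K F, P.IsAt x y α β := by
  by_contra! hall
  have hα0 := h.sub_algebraMap_ne_zero α
  obtain ⟨q, hq⟩ := X_sub_C_dvd_sub_C_eval (a := α) (p := G)
  have hq' : (y - algebraMap K F β) * (y + algebraMap K F β)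
      = (x - algebraMap K F α) * aeval x q := by
    have h1 := congrArg (aeval x) hq
    simp only [map_sub, map_mul, aeval_X, aeval_C, ← h.sq_eq, ← hβ, map_pow] at h1
    rw [← h1]
    ring
  obtain ⟨a, b, hab⟩ := h.exists_eq_of_forall_place hG hd
    ((y + algebraMap K F β) / (x - algebraMap K F α)) (by
      intro P hP
      have hy := h.v_y_le_one hP
      have hx1 := P.v.map_sub_le hP (P.v_algebraMap_le_one α)
      have hy1 := P.v.map_sub_le hy (P.v_algebraMap_le_one β)
      have hy2 := P.v.map_add_le hy (P.v_algebraMap_le_one β)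
      -- Where `x - α` vanishes, `y - β` is a unit by assumption, so the quotient has the valuation
      -- of `q(x)`; elsewhere the denominator is a unit.
      rcases hx1.lt_or_eq with hlt | heq
      · have hy3 : P.v (y - algebraMap K F β) = 1 :=
          hy1.eq_of_not_lt fun hlt' => hall P ⟨hlt, hlt'⟩
        have h2 := congrArg P.v hq'
        rw [map_mul, map_mul, hy3, one_mul] at h2
        rw [map_div₀, h2, mul_div_cancel_left₀ _ (P.v_ne_zero hα0)]
        exact P.v_aeval_le_one hP q
      · rwa [map_div₀, heq, div_one])
  rw [div_eq_iff hα0] at hab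
  have h3 := (h.eq_zero_of_add_mul_eq_zero hG hd (a := a * (X - C α) - C β)
    (b := b * (X - C α) - 1) (by
      simp only [map_sub, map_mul, aeval_X, aeval_C, map_one]
      linear_combination -hab)).2
  have h4 := congrArg (eval α) h3
  simp at h4

/-- At a point with `β ≠ 0`, the function `x - α` generates the maximal ideal of the local ring. -/
theorem exists_eq_zpow_mul (h : IsModel G x y) (hG : Squarefree G) (hd : 0 < G.natDegree)
    (hβ0 : β ≠ 0) {g : F} (hg : g ≠ 0) :
    ∃ (n : ℤ) (u : F), g = (x - algebraMap K F α) ^ n * u ∧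
      ∀ P : Place K F, P.IsAt x y α β → P.v u = 1 := by
  have hα0 := h.sub_algebraMap_ne_zero α
  have hunit : ∀ a b : K[X], a.eval α + b.eval α * β ≠ 0 → ∀ P : Place K F, P.IsAt x y α β →
      P.v (aeval x a + aeval x b * y) = 1 := by
    intro a b hab P hP
    have hx := P.v_le_one_of_sub_lt hP.1
    have hy := P.v_le_one_of_sub_lt hP.2
    refine (P.v.map_add_le (P.v_aeval_le_one hx a) ?_).eq_of_not_lt ?_
    · rw [map_mul]
      exact mul_le_one' (P.v_aeval_le_one hx b) hy
    · rw [P.v_lt_one_iff_of_sub_lt (g := algebraMap K F (a.eval α + b.eval α * β)),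
        P.v_algebraMap_lt_one_iff]
      · exact hab
      · have : aeval x a + aeval x b * y - algebraMap K F (a.eval α + b.eval α * β)
            = (aeval x a - algebraMap K F (a.eval α)) + ((aeval x b - algebraMap K F (b.eval α)) * y
              + algebraMap K F (b.eval α) * (y - algebraMap K F β)) := by
          simp only [map_add, map_mul]; ring
        rw [this]
        refine P.v.map_add_lt (P.v_aeval_sub_lt_one hP.1 a) (P.v.map_add_lt ?_ ?_)
        · rw [map_mul]
          exact mul_lt_one_of_lt_of_le (P.v_aeval_sub_lt_one hP.1 b) hy
        · rw [map_mul, mul_comm]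
          exact mul_lt_one_of_lt_of_le hP.2 (P.v_algebraMap_le_one _)
  have hpoly : ∀ c : K[X], c ≠ 0 → ∃ (n : ℕ) (u : F), aeval x c = (x - algebraMap K F α) ^ n * u ∧
      ∀ P : Place K F, P.IsAt x y α β → P.v u = 1 := by
    intro c hc
    obtain ⟨q, hq, hq0⟩ := exists_eq_pow_rootMultiplicity_mul_and_not_dvd c hc α
    refine ⟨c.rootMultiplicity α, aeval x q, ?_, fun P hP => ?_⟩
    · conv_lhs => rw [hq]
      simp
    · have := hunit q 0 (by simpa [dvd_iff_isRoot] using hq0) P hP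
      simpa using this
  have main : ∀ (m : ℕ) (a b : K[X]), a.natDegree + b.natDegree ≤ m → ¬ (a = 0 ∧ b = 0) →
      ∃ (n : ℤ) (u : F), aeval x a + aeval x b * y = (x - algebraMap K F α) ^ n * u ∧
      ∀ P : Place K F, P.IsAt x y α β → P.v u = 1 := by
    intro m
    induction m using Nat.strong_induction_on with
    | _ m ih =>
    intro a b hm hab
    -- The induction has three cases. If `a + b y` does not vanish at `(α, β)` it is a unit. If its
    -- conjugate does not vanish there, `a + b y` is the norm `a² - b² G` divided by a unit. If both
    -- vanish, then `β ≠ 0` makes `a` and `b` divisible by `X - α`, and the degree drops.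
    by_cases h1 : a.eval α + b.eval α * β = 0
    swap
    · exact ⟨0, _, (by rw [zpow_zero, one_mul]), hunit a b h1⟩
    by_cases h2 : a.eval α + (-b).eval α * β = 0
    swap
    · obtain ⟨n, u, hn, hu⟩ := hpoly _ (h.sq_sub_ne_zero hG hd hab)
      have hne : aeval x a + aeval x (-b) * y ≠ 0 := fun h0 => by
        have := h.eq_zero_of_add_mul_eq_zero hG hd h0
        exact hab (by simpa using this)
      refine ⟨n, u / (aeval x a + aeval x (-b) * y), ?_, fun P hP => ?_⟩
      · rw [zpow_natCast, ← mul_div_assoc, ← hn, eq_div_iff hne]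
        simp only [map_sub, map_mul, map_pow, map_neg, ← h.sq_eq]
        ring
      · rw [map_div₀, hu P hP, hunit a (-b) h2 P hP, div_one]
    rw [eval_neg] at h2
    have hb : b.eval α = 0 := by
      have h3 : 2 * β * b.eval α = 0 := by linear_combination h1 - h2
      simpa [hβ0] using h3
    have ha : a.eval α = 0 := by simpa [hb] using h1
    obtain ⟨a, rfl⟩ := dvd_iff_isRoot.2 ha
    obtain ⟨b, rfl⟩ := dvd_iff_isRoot.2 hb
    have hab' : ¬ (a = 0 ∧ b = 0) := by
      rintro ⟨rfl, rfl⟩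
      simp at hab
    have hdeg : ∀ p : K[X], p ≠ 0 → ((X - C α) * p).natDegree = 1 + p.natDegree := fun p hp => by
      rw [natDegree_mul (X_sub_C_ne_zero α) hp, natDegree_X_sub_C]
    have hlt : a.natDegree + b.natDegree < m := by
      by_cases ha0 : a = 0
      · have := hdeg b fun hb0 => hab' ⟨ha0, hb0⟩
        simp [ha0] at hm ⊢
        omega
      · have := hdeg a ha0
        by_cases hb0 : b = 0
        · simp [hb0] at hm ⊢
          omega
        · have := hdeg b hb0
          omega
    obtain ⟨n, u, hn, hu⟩ := ih _ hlt a b le_rfl hab'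
    refine ⟨n + 1, u, ?_, hu⟩
    rw [zpow_add_one₀ hα0, mul_right_comm, ← hn]
    simp only [map_mul, map_sub, aeval_X, aeval_C]
    ring
  obtain ⟨a, b, c, hc, hgc⟩ := h.exists_repr hG hd g
  have hab : ¬ (a = 0 ∧ b = 0) := by
    rintro ⟨rfl, rfl⟩
    exact mul_ne_zero (h.aeval_ne_zero hc) hg (by simpa using hgc)
  obtain ⟨n, u, hu, hu1⟩ := main _ a b le_rfl hab
  obtain ⟨n', u', hu', hu1'⟩ := hpoly c hc
  refine ⟨n - n', u / u', ?_, fun P hP => by rw [map_div₀, hu1 P hP, hu1' P hP, div_one]⟩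
  have h0 := h.aeval_ne_zero hc
  rw [hu'] at h0
  rw [hu, hu'] at hgc
  rw [zpow_sub₀ hα0, zpow_natCast, div_mul_div_comm, eq_div_iff h0, ← hgc, mul_comm]

/-- Valuations of places are surjective, so some function has order `1`; it is a power of `x - α`
times a unit, and the positive order of `x - α` divides `1`. -/
theorem ord_sub_eq_one (h : IsModel G x y) (hG : Squarefree G) (hd : 0 < G.natDegree)
    (hβ0 : β ≠ 0) {P : Place K F} (hP : P.IsAt x y α β) :
    P.ord (x - algebraMap K F α) = 1 := by
  obtain ⟨g, hg⟩ := P.surjective (WithZero.exp (-1))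
  have hg0 : g ≠ 0 := by
    rintro rfl
    rw [map_zero] at hg
    exact WithZero.exp_ne_zero hg.symm
  obtain ⟨n, u, hgu, hu⟩ := h.exists_eq_zpow_mul (α := α) hG hd hβ0 hg0
  have h1 : (-1 : ℤ) = n * -P.ord (x - algebraMap K F α) := by
    have h2 := congrArg (fun t => WithZero.log (P.v t)) hgu
    simp only [hg, map_mul, map_zpow₀, hu P hP, mul_one, WithZero.log_exp, WithZero.log_zpow,
      smul_eq_mul] at h2
    rw [h2, Place.ord, neg_neg]
  have h2 := (P.v_lt_one_iff (h.sub_algebraMap_ne_zero α)).1 hP.1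
  refine Int.eq_one_of_dvd_one h2.le ⟨n, ?_⟩
  linarith

/-- In `exists_eq_zpow_mul` the exponent and the cofactor do not depend on the place, so neither
does the valuation. -/
theorem isAt_unique (h : IsModel G x y) (hG : Squarefree G) (hd : 0 < G.natDegree)
    (hβ0 : β ≠ 0) {P Q : Place K F} (hP : P.IsAt x y α β)
    (hQ : Q.IsAt x y α β) : P = Q := by
  ext g
  by_cases hg : g = 0
  · simp [hg]
  obtain ⟨n, u, hgu, hu⟩ := h.exists_eq_zpow_mul (α := α) hG hd hβ0 hg
  have h0 := h.sub_algebraMap_ne_zero α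
  rw [hgu, map_mul, map_mul, map_zpow₀, map_zpow₀, hu P hP, hu Q hQ, P.v_eq_exp h0, Q.v_eq_exp h0,
    h.ord_sub_eq_one hG hd hβ0 hP, h.ord_sub_eq_one hG hd hβ0 hQ]

end IsModel

/-! ### Divisors in Mumford form and fibres of `x` -/

open Classical in
/-- The multiplicity at `P` of the effective divisor with Mumford representation `(u, v)`, which is
cut out by `u(x)` and `y - v(x)` on the affine part of the curve. -/
def mumfordOrd {K F : Type*} [Field K] [Field F] [Algebra K F] (x y : F) (u v : K[X])
    (P : Place K F) : ℤ :=
  if P.v x ≤ 1 ∧ P.v (y - aeval x v) < 1 then P.ord (aeval x u) else 0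

open Classical in
/-- The multiplicity at `P` of the fiber of `x` over `c`. -/
def fiberOrd {K F : Type*} [Field K] [Field F] [Algebra K F] (x : F) (c : K) (P : Place K F) : ℤ :=
  if P.v x ≤ 1 then P.ord (x - algebraMap K F c) else 0

section

variable {K F : Type*} [Field K] [Field F] [Algebra K F] {x y : F} {u v w : K[X]} {P : Place K F}

theorem mumfordOrd_of_v_eq_one (h : P.v (aeval x u) = 1) : mumfordOrd x y u v P = 0 := by
  rw [mumfordOrd, P.ord_eq_zero_of_v_eq_one h, ite_self]

theorem mumfordOrd_congr (h : u ∣ w - v) : mumfordOrd x y u v P = mumfordOrd x y u w P := by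
  by_cases hx : P.v x ≤ 1
  · rcases (P.v_aeval_le_one hx u).lt_or_eq with hu | hu
    · obtain ⟨q, hq⟩ := h
      have : P.v (y - aeval x v - (y - aeval x w)) < 1 := by
        rw [sub_sub_sub_cancel_left, ← map_sub, hq, map_mul, map_mul]
        exact mul_lt_one_of_lt_of_le hu (P.v_aeval_le_one hx q)
      simp only [mumfordOrd, P.v_lt_one_iff_of_sub_lt this]
    · rw [mumfordOrd_of_v_eq_one hu, mumfordOrd_of_v_eq_one hu]
  · simp [mumfordOrd, hx]

end

/-! ### Functions realizing the linear equivalences, and nonvanishing of classes -/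

namespace IsModel

variable {K F : Type*} [Field K] [Field F] [Algebra K F] {G : K[X]} {x y : F}

/-- The poles of `y` at infinity are three times those of `x`, because `y² = G(x)` and `G` has
degree six. -/
theorem v_y_of_one_lt (h : IsModel G x y) (hG6 : G.natDegree = 6) {P : Place K F}
    (hx : 1 < P.v x) : P.v y = P.v x ^ 3 := by
  have h1 := P.v_aeval_of_one_lt hx (p := G) (by rintro rfl; simp at hG6)
  rw [← h.sq_eq, map_pow, hG6, show 6 = 3 * 2 by rfl, pow_mul] at h1
  exact (pow_left_inj₀ zero_le zero_le two_ne_zero).1 h1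

theorem mumfordOrd_mul (h : IsModel G x y) {u₁ u₂ : K[X]} (h₁ : u₁ ≠ 0) (h₂ : u₂ ≠ 0) (v : K[X])
    (P : Place K F) :
    mumfordOrd x y (u₁ * u₂) v P = mumfordOrd x y u₁ v P + mumfordOrd x y u₂ v P := by
  simp only [mumfordOrd, map_mul]
  split_ifs
  · rw [P.ord_mul (h.aeval_ne_zero h₁) (h.aeval_ne_zero h₂)]
  · simp

variable [CharZero K]

/-- The local formula `mumfordOrd` is turned into a finitely supported sum of points `(a, v(a))`,
counted with the multiplicities of the roots. The condition `v(a) ≠ 0` makes `x - a` a uniformizer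
there, so each linear factor contributes exactly one point. -/
theorem exists_divisor_of_prod (h : IsModel G x y) (hG : Squarefree G) (hd : 0 < G.natDegree)
    {v : K[X]} (s : Multiset K) (hs : ∀ a ∈ s, v.eval a ^ 2 = G.eval a ∧ v.eval a ≠ 0) :
    ∃ D : CurveDivisor K F, (∀ P, D P = mumfordOrd x y (s.map fun a => X - C a).prod v P) ∧
      D.degree = Multiset.card s := by
  induction s using Multiset.induction_on with
  | empty =>
    refine ⟨0, fun P => ?_, by simp⟩
    rw [mumfordOrd_of_v_eq_one (by simp)]
    rfl
  | cons a s ih =>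
    obtain ⟨D, hD, hdeg⟩ := ih fun b hb => hs b (Multiset.mem_cons_of_mem hb)
    obtain ⟨hβ, hβ0⟩ := hs a (Multiset.mem_cons_self a s)
    obtain ⟨Q, hQ⟩ := h.exists_isAt hG hd hβ
    refine ⟨Finsupp.single Q 1 + D, fun P => ?_, ?_⟩
    swap
    · rw [map_add, hdeg, Finsupp.degree_single, Multiset.card_cons]
      push_cast
      ring
    rw [Finsupp.add_apply, hD, Multiset.map_cons, Multiset.prod_cons]
    have hne : aeval x (s.map fun a => X - C a).prod ≠ 0 :=
      h.aeval_ne_zero (monic_multiset_prod_of_monic _ _ fun a _ => monic_X_sub_C a).ne_zero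
    have hval : ∀ P : Place K F, P.v (x - algebraMap K F a) < 1 →
        (P.v (y - aeval x v) < 1 ↔ P.IsAt x y a (v.eval a)) := by
      intro P hP
      rw [Place.IsAt, and_iff_right hP]
      apply P.v_lt_one_iff_of_sub_lt
      rw [sub_sub_sub_cancel_left, P.v.map_sub_swap]
      exact P.v_aeval_sub_lt_one hP v
    simp only [mumfordOrd]
    by_cases hc : P.v x ≤ 1 ∧ P.v (y - aeval x v) < 1
    · rw [if_pos hc, if_pos hc, map_mul, P.ord_mul (h.aeval_ne_zero (X_sub_C_ne_zero a)) hne]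
      congr 1
      rw [map_sub, aeval_X, aeval_C]
      rcases (P.v.map_sub_le hc.1 (P.v_algebraMap_le_one a)).lt_or_eq with hlt | heq
      · have hP := (hval P hlt).1 hc.2
        rw [h.ord_sub_eq_one hG hd hβ0 hP, h.isAt_unique hG hd hβ0 hP hQ, Finsupp.single_eq_same]
      · rw [P.ord_eq_zero_of_v_eq_one heq, Finsupp.single_eq_of_ne]
        rintro rfl
        exact hQ.1.ne heq
    · rw [if_neg hc, if_neg hc, add_zero, Finsupp.single_eq_of_ne]
      rintro rfl
      exact hc ⟨P.v_le_one_of_sub_lt hQ.1, (hval P hQ.1).2 hQ⟩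

theorem exists_divisor [IsAlgClosed K] (h : IsModel G x y) (hG : Squarefree G)
    (hd : 0 < G.natDegree) {u v : K[X]} (hu : u.Monic) (hdvd : u ∣ v ^ 2 - G)
    (hcop : IsCoprime u v) :
    ∃ D : CurveDivisor K F, (∀ P, D P = mumfordOrd x y u v P) ∧ D.degree = u.natDegree := by
  have hsp := IsAlgClosed.splits u
  obtain ⟨D, hD, hdeg⟩ := h.exists_divisor_of_prod hG hd (v := v) u.roots (by
    intro a ha
    have hr : u.eval a = 0 := (mem_roots hu.ne_zero).1 ha
    constructor
    · obtain ⟨q, hq⟩ := hdvd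
      have := congrArg (eval a) hq
      simpa [hr, sub_eq_zero] using this
    · intro hv
      obtain ⟨p, q, hpq⟩ := hcop
      have := congrArg (eval a) hpq
      simp [hr, hv] at this)
  rw [← hsp.eq_prod_roots_of_monic hu] at hD
  exact ⟨D, hD, by rw [hdeg, hsp.natDegree_eq_card_roots]⟩

/-- Since `c` is not a branch value, the fibre consists of the two distinct points `(c, γ)` and `(c,
-γ)`, each of multiplicity one. -/
theorem exists_fiber [IsAlgClosed K] (h : IsModel G x y) (hG : Squarefree G)
    (hd : 0 < G.natDegree) {c : K} (hc : G.eval c ≠ 0) :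
    ∃ D : CurveDivisor K F, (∀ P, D P = fiberOrd x c P) ∧ D.degree = 2 := by
  obtain ⟨γ, hγ⟩ := IsAlgClosed.exists_pow_nat_eq (G.eval c) two_pos
  have hγ0 : γ ≠ 0 := by
    rintro rfl
    exact hc (by rw [← hγ]; simp)
  have hex : ∀ β : K, β ^ 2 = G.eval c → ∃ D : CurveDivisor K F,
      (∀ P, D P = mumfordOrd x y (X - C c) (C β) P) ∧ D.degree = 1 := by
    intro β hβ
    have hβ0 : β ≠ 0 := by
      rintro rfl
      exact hc (by rw [← hβ]; simp)
    have := h.exists_divisor_of_prod hG hd (v := C β) {c} (by simpa using ⟨hβ, hβ0⟩)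
    simpa using this
  obtain ⟨D, hD, hdeg⟩ := hex γ hγ
  obtain ⟨E, hE, hdeg'⟩ := hex (-γ) (by rw [neg_sq, hγ])
  refine ⟨D + E, fun P => ?_, by rw [map_add, hdeg, hdeg']; rfl⟩
  rw [Finsupp.add_apply, hD, hE]
  simp only [mumfordOrd, fiberOrd, map_sub, aeval_X, aeval_C]
  by_cases hx : P.v x ≤ 1
  swap
  · simp [hx]
  rcases (P.v.map_sub_le hx (P.v_algebraMap_le_one c)).lt_or_eq with hlt | heq
  swap
  · simp [P.ord_eq_zero_of_v_eq_one heq]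
  have h1 : P.v (y - algebraMap K F γ) < 1 ∨ P.v (y - algebraMap K F (-γ)) < 1 := by
    by_contra! hcon
    have h2 := P.v_aeval_sub_lt_one hlt G
    rw [← h.sq_eq, ← hγ] at h2
    have h3 : y ^ 2 - algebraMap K F (γ ^ 2)
        = (y - algebraMap K F γ) * (y - algebraMap K F (-γ)) := by
      simp only [map_neg, map_pow]; ring
    rw [h3, map_mul] at h2
    exact h2.not_ge (one_le_mul hcon.1 hcon.2)
  have h2 : ¬ (P.v (y - algebraMap K F γ) < 1 ∧ P.v (y - algebraMap K F (-γ)) < 1) := by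
    rintro ⟨h3, h4⟩
    have h5 := P.v.map_sub_lt h4 h3
    rw [sub_sub_sub_cancel_left, ← map_sub, P.v_algebraMap_lt_one_iff] at h5
    exact hγ0 (by linear_combination h5 / 2)
  rcases h1 with h1 | h1
  · have h3 : ¬ P.v (y - algebraMap K F (-γ)) < 1 := fun h3 => h2 ⟨h1, h3⟩
    simp only [hx, h1, h3, and_true, and_false, if_true, if_false, add_zero]
  · have h3 : ¬ P.v (y - algebraMap K F γ) < 1 := fun h3 => h2 ⟨h3, h1⟩
    simp only [hx, h1, h3, and_true, and_false, if_true, if_false, zero_add]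

/-- The zeros of `y - V(x)`. -/
theorem mumfordOrd_eq_ord (h : IsModel G x y) (hG : Squarefree G) (hG6 : G.natDegree = 6)
    {U V : K[X]} {κ : K} (hκ : κ ≠ 0) (hU : U.natDegree = 6) (hV : V.natDegree ≤ 3)
    (hUV : V ^ 2 - G = C κ * U) (hcop : IsCoprime U V) (c : K) (P : Place K F) :
    mumfordOrd x y U V P - 3 * fiberOrd x c P
      = P.ord ((y - aeval x V) / (x - algebraMap K F c) ^ 3) := by
  have hd : 0 < G.natDegree := by omega
  have hU0 : U ≠ 0 := by rintro rfl; simp at hU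
  have hne : ∀ s : K[X], s ≠ 0 → y + aeval x V * aeval x s ≠ 0 := by
    intro s _ h0
    have := h.eq_zero_of_add_mul_eq_zero hG hd (a := V * s) (b := 1) (by
      rw [← h0]; simp [add_comm])
    exact one_ne_zero this.2
  have hne1 : y - aeval x V ≠ 0 := by
    have := hne (-1) (by simp)
    simpa [sub_eq_add_neg] using this
  have hne2 : y + aeval x V ≠ 0 := by simpa using hne 1 one_ne_zero
  have hc0 := h.sub_algebraMap_ne_zero c
  have hprod : (y - aeval x V) * (y + aeval x V) = -(algebraMap K F κ * aeval x U) := by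
    have := congrArg (aeval x) hUV
    simp only [map_sub, map_mul, map_pow, aeval_C, ← h.sq_eq] at this
    linear_combination -this
  have hvprod : P.v (y - aeval x V) * P.v (y + aeval x V) = P.v (aeval x U) := by
    rw [← map_mul, hprod, Valuation.map_neg, map_mul, P.trivial κ hκ, one_mul]
  rw [P.ord_div hne1 (pow_ne_zero 3 hc0), P.ord_pow, mumfordOrd, fiberOrd]
  by_cases hx : P.v x ≤ 1
  · rw [if_pos hx]
    push_cast
    congr 1
    have hy := h.v_y_le_one hx
    have hVx := P.v_aeval_le_one hx V
    by_cases hlt : P.v (y - aeval x V) < 1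
    · rw [if_pos ⟨hx, hlt⟩]
      apply P.ord_congr
      -- If `y - V` and `y + V` both vanished, so would `V` and `U`, against coprimality. Hence `y -
      -- V` carries the whole order of `U`.
      have h1 : P.v (y + aeval x V) = 1 := by
        refine (P.v.map_add_le hy hVx).eq_of_not_lt fun h2 => ?_
        have h3 : P.v (aeval x V) < 1 := by
          have := P.v.map_sub_lt h2 hlt
          rwa [add_sub_sub_cancel, ← two_mul, map_mul, P.v_ofNat, one_mul] at this
        have h4 : P.v (aeval x U) < 1 := by
          rw [← hvprod]
          exact mul_lt_one_of_lt_of_le hlt h2.le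
        obtain ⟨p, q, hpq⟩ := hcop
        have h5 := congrArg (aeval x) hpq
        simp only [map_add, map_mul, map_one] at h5
        have h6 : P.v (1 : F) < 1 := by
          rw [← h5]
          refine P.v.map_add_lt ?_ ?_
          · rw [map_mul, mul_comm]
            exact mul_lt_one_of_lt_of_le h4 (P.v_aeval_le_one hx p)
          · rw [map_mul, mul_comm]
            exact mul_lt_one_of_lt_of_le h3 (P.v_aeval_le_one hx q)
        rw [map_one] at h6
        exact h6.false
      rw [← hvprod, h1, mul_one]
    · rw [if_neg fun h1 => hlt h1.2,
        P.ord_eq_zero_of_v_eq_one ((P.v.map_sub_le hy hVx).eq_of_not_lt hlt)]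
  · rw [if_neg fun h1 => hx h1.1, if_neg hx]
    rw [not_le] at hx
    have hy := h.v_y_of_one_lt hG6 hx
    have hVx := P.v_aeval_le_of_one_lt hx hV
    have h1 := P.v.map_sub_le hy.le hVx
    have h2 := P.v.map_add_le hy.le hVx
    rw [P.v_aeval_of_one_lt hx hU0, hU, show 6 = 3 + 3 by rfl, pow_add] at hvprod
    have hpos : 0 < P.v x ^ 3 := pow_pos (zero_lt_one.trans hx) 3
    -- At infinity both factors have at most the poles of `x³`, while their product has exactly
    -- those of `x⁶` because `U` has degree six; so both bounds are attained.
    have h3 : P.v (y - aeval x V) = P.v x ^ 3 := by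
      refine h1.eq_of_not_lt fun hlt => ?_
      have : P.v (y - aeval x V) * P.v (y + aeval x V) < P.v x ^ 3 * P.v x ^ 3 :=
        (mul_le_mul_right h2 _).trans_lt (mul_lt_mul_of_pos_right hlt hpos)
      exact this.ne hvprod
    have h4 : P.ord (y - aeval x V) = P.ord ((x - algebraMap K F c) ^ 3) := by
      apply P.ord_congr
      rw [h3, map_pow, P.v_sub_algebraMap_of_one_lt hx]
    rw [h4, P.ord_pow]
    ring

/-- The divisors `(u, v)` and `(u, -v)` are conjugate. -/
theorem mumfordOrd_add_neg (h : IsModel G x y) {u v : K[X]} (hu : u ≠ 0) (hdeg : u.natDegree = 2)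
    (hdvd : u ∣ v ^ 2 - G) (hcop : IsCoprime u v) (c : K) (P : Place K F) :
    mumfordOrd x y u v P + mumfordOrd x y u (-v) P - 2 * fiberOrd x c P
      = P.ord (aeval x u / (x - algebraMap K F c) ^ 2) := by
  have hc0 := h.sub_algebraMap_ne_zero c
  rw [P.ord_div (h.aeval_ne_zero hu) (pow_ne_zero 2 hc0), P.ord_pow]
  by_cases hx : P.v x ≤ 1
  · rw [fiberOrd, if_pos hx]
    push_cast
    congr 1
    rcases (P.v_aeval_le_one hx u).lt_or_eq with hlt | heq
    swap
    · rw [mumfordOrd_of_v_eq_one heq, mumfordOrd_of_v_eq_one heq, P.ord_eq_zero_of_v_eq_one heq,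
        add_zero]
    obtain ⟨q, hq⟩ := hdvd
    -- Over a root of `u` the product `(y - v)(y + v)` vanishes, but by coprimality not both factors
    -- do: exactly one of the two conjugate divisors contains the place.
    have h1 : P.v (y - aeval x v) < 1 ∨ P.v (y - aeval x (-v)) < 1 := by
      by_contra! hcon
      have h2 : P.v ((y - aeval x v) * (y - aeval x (-v))) < 1 := by
        have h3 := congrArg (aeval x) hq
        simp only [map_sub, map_mul, map_pow, ← h.sq_eq] at h3
        rw [show (y - aeval x v) * (y - aeval x (-v)) = -(aeval x u * aeval x q) by
          rw [← h3, map_neg]; ring, Valuation.map_neg, map_mul]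
        exact mul_lt_one_of_lt_of_le hlt (P.v_aeval_le_one hx q)
      rw [map_mul] at h2
      exact h2.not_ge (one_le_mul hcon.1 hcon.2)
    have h2 : ¬ (P.v (y - aeval x v) < 1 ∧ P.v (y - aeval x (-v)) < 1) := by
      rintro ⟨h3, h4⟩
      have h5 := P.v.map_sub_lt h4 h3
      rw [sub_sub_sub_cancel_left, map_neg, sub_neg_eq_add, ← two_mul, map_mul, P.v_ofNat,
        one_mul] at h5
      obtain ⟨p, r, hpr⟩ := hcop
      have h6 := congrArg (aeval x) hpr
      simp only [map_add, map_mul, map_one] at h6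
      have h7 : P.v (1 : F) < 1 := by
        rw [← h6]
        refine P.v.map_add_lt ?_ ?_
        · rw [map_mul, mul_comm]
          exact mul_lt_one_of_lt_of_le hlt (P.v_aeval_le_one hx p)
        · rw [map_mul, mul_comm]
          exact mul_lt_one_of_lt_of_le h5 (P.v_aeval_le_one hx r)
      rw [map_one] at h7
      exact h7.false
    simp only [mumfordOrd]
    rcases h1 with h1 | h1
    · have h3 : ¬ P.v (y - aeval x (-v)) < 1 := fun h3 => h2 ⟨h1, h3⟩
      simp only [hx, h1, h3, and_true, and_false, if_true, if_false, add_zero]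
    · have h3 : ¬ P.v (y - aeval x v) < 1 := fun h3 => h2 ⟨h3, h1⟩
      simp only [hx, h1, h3, and_true, and_false, if_true, if_false, zero_add]
  · have h1 : P.ord (aeval x u) = 2 * P.ord (x - algebraMap K F c) := by
      rw [not_le] at hx
      have := P.ord_pow (f := x - algebraMap K F c) 2
      push_cast at this
      rw [← this]
      apply P.ord_congr
      rw [P.v_aeval_of_one_lt hx hu, hdeg, map_pow, P.v_sub_algebraMap_of_one_lt hx]
    simp [mumfordOrd, fiberOrd, hx, h1]

/-- A function whose poles are at most `m ≤ 2` times those of `x` is a polynomial in `x`. -/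
theorem exists_aeval_eq_of_poles (h : IsModel G x y) (hG : Squarefree G) (hG6 : G.natDegree = 6)
    {f : F} (hf : ∀ P : Place K F, P.v x ≤ 1 → P.v f ≤ 1)
    (hf' : ∀ P : Place K F, 1 < P.v x → P.v f ≤ P.v x ^ 2) : ∃ a : K[X], f = aeval x a := by
  have hd : 0 < G.natDegree := by omega
  obtain ⟨a, b, rfl⟩ := h.exists_eq_of_forall_place hG hd f hf
  refine ⟨a, ?_⟩
  suffices hb : b = 0 by simp [hb]
  by_contra hb
  obtain ⟨τ, hτx, hτy⟩ := h.exists_involution hG hd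
  obtain ⟨P, hP⟩ := h.exists_place_one_lt
  have h1 := hf' P hP
  -- The bound also holds at the conjugate place, hence for `τ f` at `P`. It then holds for `f - τ f
  -- = 2 b y`, whose pole is at least three times that of `x` if `b ≠ 0`.
  have hp : ∀ p : K[X], τ (aeval x p) = aeval x p := fun p => by
    rw [← aeval_algHom_apply, hτx]
  have h2 := hf' ((Place.transport (RingEquiv.refl K) (τ.symm : F ≃+* F) fun c => by simp) P) (by
    change 1 < P.v (τ x)
    rwa [hτx])
  change P.v (τ (aeval x a + aeval x b * y)) ≤ P.v (τ x) ^ 2 at h2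
  rw [map_add, map_mul, hp, hp, hτx, hτy] at h2
  have h3 := P.v.map_sub_le h1 h2
  rw [show aeval x a + aeval x b * y - (aeval x a + aeval x b * -y) = 2 * (aeval x b * y) by ring,
    map_mul, P.v_ofNat, one_mul, map_mul, P.v_aeval_of_one_lt hP hb, h.v_y_of_one_lt hG6 hP,
    ← pow_add] at h3
  exact (pow_lt_pow_right₀ hP (by omega : 2 < b.natDegree + 3)).not_ge h3

/-- The class of `(u, v)` minus a fiber, and its double, are not zero. -/
theorem ord_ne_mul_mumfordOrd_sub [IsAlgClosed K] (h : IsModel G x y) (hG : Squarefree G)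
    (hG6 : G.natDegree = 6) {u v : K[X]} (hdeg : u.natDegree = 2) (hdvd : u ∣ v ^ 2 - G)
    (hcop : IsCoprime u v) {c : K} {m : ℕ} (hm0 : m ≠ 0) (hm : m ≤ 2) {f : F} (hf0 : f ≠ 0)
    (hf : ∀ P : Place K F, m * (mumfordOrd x y u v P - fiberOrd x c P) = P.ord f) : False := by
  have hd : 0 < G.natDegree := by omega
  have hu : u ≠ 0 := by rintro rfl; simp at hdeg
  have hc0 := h.sub_algebraMap_ne_zero c
  have hg0 : f * (x - algebraMap K F c) ^ m ≠ 0 := mul_ne_zero hf0 (pow_ne_zero m hc0)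
  have hord : ∀ P : Place K F, P.ord (f * (x - algebraMap K F c) ^ m)
      = m * (mumfordOrd x y u v P - fiberOrd x c P + P.ord (x - algebraMap K F c)) := by
    intro P
    rw [P.ord_mul hf0 (pow_ne_zero m hc0), ← hf, P.ord_pow]
    ring
  have haff : ∀ P : Place K F, P.v x ≤ 1 → P.ord (f * (x - algebraMap K F c) ^ m)
      = m * mumfordOrd x y u v P := by
    intro P hx
    rw [hord, fiberOrd, if_pos hx]
    ring
  obtain ⟨a, ha⟩ := h.exists_aeval_eq_of_poles hG hG6 (f := f * (x - algebraMap K F c) ^ m) (by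
    intro P hx
    rw [P.v_le_one_iff hg0, haff P hx]
    refine mul_nonneg (by positivity) ?_
    rw [mumfordOrd]
    split_ifs
    · exact (P.v_le_one_iff (h.aeval_ne_zero hu)).1 (P.v_aeval_le_one hx u)
    · exact le_rfl) (by
    intro P hx
    have h1 : P.v (f * (x - algebraMap K F c) ^ m) = P.v ((x - algebraMap K F c) ^ m) := by
      rw [P.v_eq_exp hg0, P.v_eq_exp (pow_ne_zero m hc0), hord, P.ord_pow]
      simp [mumfordOrd, fiberOrd, hx.not_ge]
    rw [h1, map_pow, P.v_sub_algebraMap_of_one_lt hx]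
    exact pow_le_pow_right₀ hx.le hm)
  -- The contradiction is at the points `(α, v(α))` and `(α, -v(α))` over a root of `u`: the
  -- polynomial in `x` vanishes at the first, not at the second.
  obtain ⟨α, hα⟩ := IsAlgClosed.exists_root u (by
    rw [degree_eq_natDegree hu, hdeg]; exact two_ne_zero)
  have hα' : u.eval α = 0 := hα
  have hv : v.eval α ^ 2 = G.eval α := by
    obtain ⟨q, hq⟩ := hdvd
    have := congrArg (eval α) hq
    simpa [hα', sub_eq_zero] using this
  have hv0 : v.eval α ≠ 0 := by
    intro hv
    obtain ⟨p, q, hpq⟩ := hcop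
    have := congrArg (eval α) hpq
    simp [hα', hv] at this
  obtain ⟨P, hP⟩ := h.exists_isAt hG hd hv
  obtain ⟨Q, hQ⟩ := h.exists_isAt hG hd (β := -v.eval α) (by rw [neg_sq, hv])
  have hPx := P.v_le_one_of_sub_lt hP.1
  have hQx := Q.v_le_one_of_sub_lt hQ.1
  have hPv : P.v (y - aeval x v) < 1 := by
    rw [P.v_lt_one_iff_of_sub_lt (g := y - algebraMap K F (v.eval α))]
    · exact hP.2
    · rw [sub_sub_sub_cancel_left, P.v.map_sub_swap]
      exact P.v_aeval_sub_lt_one hP.1 v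
  have hQv : ¬ Q.v (y - aeval x v) < 1 := by
    rw [Q.v_lt_one_iff_of_sub_lt (g := algebraMap K F (-v.eval α - v.eval α)),
      Q.v_algebraMap_lt_one_iff]
    · intro h0
      exact hv0 (by linear_combination -h0 / 2)
    · rw [show y - aeval x v - algebraMap K F (-v.eval α - v.eval α)
        = (y - algebraMap K F (-v.eval α)) - (aeval x v - algebraMap K F (v.eval α)) by
          simp only [map_sub, map_neg]; ring]
      exact Q.v.map_sub_lt hQ.2 (Q.v_aeval_sub_lt_one hQ.1 v)
  have h1 : P.v (aeval x a) < 1 := by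
    rw [← ha, P.v_lt_one_iff hg0, haff P hPx, mumfordOrd, if_pos ⟨hPx, hPv⟩]
    refine mul_pos (by positivity) ?_
    rw [← P.v_lt_one_iff (h.aeval_ne_zero hu), P.v_aeval_lt_one_iff hP.1]
    exact hα'
  have h2 : ¬ Q.v (aeval x a) < 1 := by
    rw [← ha, Q.v_lt_one_iff hg0, haff Q hQx, mumfordOrd, if_neg fun h3 => hQv h3.2]
    simp
  rw [P.v_aeval_lt_one_iff hP.1] at h1
  rw [Q.v_aeval_lt_one_iff hQ.1] at h2
  exact h2 h1

end IsModel

/-! ### Rational points of the Jacobian from Mumford pairs -/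

/-- A Mumford representation `(u, v)` over `k` of an effective divisor of degree two on
`y² = G(x)` without Weierstrass points. -/
structure MumfordPair {k : Type*} [Field k] (G : k[X]) where
  u : k[X]
  v : k[X]
  monic : u.Monic
  natDegree_eq : u.natDegree = 2
  dvd : u ∣ v ^ 2 - G
  isCoprime : IsCoprime u v

namespace MumfordPair

variable {k : Type*} [Field k] {G : k[X]}

/-- The conjugate divisor. -/
def conj (p : MumfordPair G) : MumfordPair G where
  u := p.u
  v := -p.v
  monic := p.monic
  natDegree_eq := p.natDegree_eq
  dvd := by rw [neg_sq]; exact p.dvd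
  isCoprime := p.isCoprime.neg_right

/-- Base change along a field extension. -/
def map (p : MumfordPair G) (K : Type*) [Field K] [Algebra k K] :
    MumfordPair (G.map (algebraMap k K)) where
  u := p.u.map (algebraMap k K)
  v := p.v.map (algebraMap k K)
  monic := p.monic.map _
  natDegree_eq := by rw [natDegree_map, p.natDegree_eq]
  dvd := by
    rw [← Polynomial.map_pow, ← Polynomial.map_sub]
    exact Polynomial.map_dvd _ p.dvd
  isCoprime := p.isCoprime.map (mapRingHom (algebraMap k K))

end MumfordPair

namespace GenusTwoCurve

variable {k : Type*} [Field k] (X₀ : GenusTwoCurve k)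

theorem galoisFunctionField_aeval {L : Type*} [Field L] [Algebra k L] (σ : L ≃ₐ[k] L)
    {x : (X₀.baseChange L).FunctionField} (hx : X₀.galoisFunctionField σ x = x) (p : k[X]) :
    X₀.galoisFunctionField σ (aeval x (p.map (algebraMap k L)))
      = aeval x (p.map (algebraMap k L)) := by
  rw [aeval_def, eval₂_map]
  have h1 := hom_eval₂ p ((algebraMap L (X₀.baseChange L).FunctionField).comp (algebraMap k L))
    (X₀.galoisFunctionField σ).toRingHom x
  have h2 : (X₀.galoisFunctionField σ).toRingHom.comp
      ((algebraMap L (X₀.baseChange L).FunctionField).comp (algebraMap k L))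
      = (algebraMap L (X₀.baseChange L).FunctionField).comp (algebraMap k L) := by
    ext r
    exact (X₀.galoisFunctionField_algebraMap σ _).trans (by simp)
  rw [h2] at h1
  exact h1.trans (congrArg (fun t => eval₂ _ t p) hx)

/-- A model `y² = G(x)` of degree six, with `x` and `y` rational over `k`, of the curve over the
algebraic closure of `k`, together with a value `c` of `x` that is not a branch point. -/
structure RationalModel (G : k[X]) (x y : (X₀.baseChange (AlgebraicClosure k)).FunctionField)
    (c : k) : Prop where
  isModel : IsModel (G.map (algebraMap k (AlgebraicClosure k))) x y
  separable : G.Separable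
  natDegree_eq : G.natDegree = 6
  map_x : ∀ σ : AlgebraicClosure k ≃ₐ[k] AlgebraicClosure k, X₀.galoisFunctionField σ x = x
  map_y : ∀ σ : AlgebraicClosure k ≃ₐ[k] AlgebraicClosure k, X₀.galoisFunctionField σ y = y
  eval_ne_zero : G.eval c ≠ 0

namespace RationalModel

variable {X₀} {G : k[X]} {x y : (X₀.baseChange (AlgebraicClosure k)).FunctionField} {c : k}
  (M : X₀.RationalModel G x y c)

include M

theorem squarefree : Squarefree (G.map (algebraMap k (AlgebraicClosure k))) :=
  (M.separable.map (f := algebraMap k (AlgebraicClosure k))).squarefree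

theorem natDegree_map_eq : (G.map (algebraMap k (AlgebraicClosure k))).natDegree = 6 := by
  rw [natDegree_map, M.natDegree_eq]

theorem natDegree_map_pos : 0 < (G.map (algebraMap k (AlgebraicClosure k))).natDegree := by
  rw [M.natDegree_map_eq]
  norm_num

variable [CharZero k]

theorem exists_divisor (p : MumfordPair G) :
    ∃ D : CurveDivisor (AlgebraicClosure k) (X₀.baseChange (AlgebraicClosure k)).FunctionField,
      (∀ P, D P = mumfordOrd x y (p.map (AlgebraicClosure k)).u (p.map (AlgebraicClosure k)).v P
        - fiberOrd x (algebraMap k (AlgebraicClosure k) c) P) ∧ D.degree = 0 := by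
  set q := p.map (AlgebraicClosure k)
  obtain ⟨D, hD, hdeg⟩ := M.isModel.exists_divisor M.squarefree M.natDegree_map_pos q.monic q.dvd
    q.isCoprime
  obtain ⟨E, hE, hdeg'⟩ := M.isModel.exists_fiber M.squarefree M.natDegree_map_pos
    (c := algebraMap k (AlgebraicClosure k) c) (by
      rw [eval_map_algebraMap, aeval_algebraMap_apply, Ne, map_eq_zero]
      exact M.eval_ne_zero)
  refine ⟨D - E, fun P => by rw [Finsupp.sub_apply, hD, hE], ?_⟩
  rw [map_sub, hdeg, hdeg', q.natDegree_eq]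
  norm_num

/-- The divisor of degree zero associated with a Mumford representation. -/
def divisor (p : MumfordPair G) :
    CurveDivisor (AlgebraicClosure k) (X₀.baseChange (AlgebraicClosure k)).FunctionField :=
  Classical.choose (M.exists_divisor p)

theorem divisor_apply (p : MumfordPair G)
    (P : Place (AlgebraicClosure k) (X₀.baseChange (AlgebraicClosure k)).FunctionField) :
    M.divisor p P = mumfordOrd x y (p.map (AlgebraicClosure k)).u (p.map (AlgebraicClosure k)).v P
        - fiberOrd x (algebraMap k (AlgebraicClosure k) c) P :=
  (Classical.choose_spec (M.exists_divisor p)).1 P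

theorem degree_divisor (p : MumfordPair G) : (M.divisor p).degree = 0 :=
  (Classical.choose_spec (M.exists_divisor p)).2

/-- The divisor itself is Galois-stable, not merely its class: its multiplicities are defined by
`x`, `y`, `u`, `v` and `c`, all rational over `k`. -/
theorem galoisPicard_divisor (σ : AlgebraicClosure k ≃ₐ[k] AlgebraicClosure k)
    (p : MumfordPair G) :
    X₀.galoisPicard σ (QuotientAddGroup.mk (M.divisor p)) = QuotientAddGroup.mk (M.divisor p) := by
  rw [galoisPicard, PicardGroup.transport, QuotientAddGroup.map_mk]
  congr 1
  ext P
  change M.divisor p ((Place.transport (σ : AlgebraicClosure k ≃+* AlgebraicClosure k)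
    (X₀.galoisFunctionField σ) (X₀.galoisFunctionField_algebraMap σ)).symm P) = _
  set Q := (Place.transport (σ : AlgebraicClosure k ≃+* AlgebraicClosure k)
    (X₀.galoisFunctionField σ) (X₀.galoisFunctionField_algebraMap σ)).symm P
  have hQ : ∀ g, Q.v g = P.v (X₀.galoisFunctionField σ g) := fun g => rfl
  have hp : ∀ p : k[X], Q.v (aeval x (p.map (algebraMap k (AlgebraicClosure k))))
      = P.v (aeval x (p.map (algebraMap k (AlgebraicClosure k)))) := fun p => by
    rw [hQ, X₀.galoisFunctionField_aeval σ (M.map_x σ)]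
  have hx : Q.v x = P.v x := by rw [hQ, M.map_x]
  have hy : Q.v (y - aeval x (p.v.map (algebraMap k (AlgebraicClosure k))))
      = P.v (y - aeval x (p.v.map (algebraMap k (AlgebraicClosure k)))) := by
    rw [hQ, map_sub, X₀.galoisFunctionField_aeval σ (M.map_x σ), M.map_y]
  have hc := hp (X - C c)
  simp only [Polynomial.map_sub, map_X, map_C, map_sub, aeval_X, aeval_C] at hc
  rw [divisor_apply, divisor_apply]
  simp only [mumfordOrd, fiberOrd, MumfordPair.map, Place.ord, hx, hy, hp, hc]
  congr!

/-- The point on the Jacobian with a given Mumford representation. -/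
def point (p : MumfordPair G) : X₀.jacobianPoints :=
  ⟨QuotientAddGroup.mk (M.divisor p), by
    refine AddSubgroup.mem_inf.2 ⟨⟨M.divisor p, M.degree_divisor p, rfl⟩,
      AddSubgroup.mem_iInf.2 fun σ => M.galoisPicard_divisor σ p⟩⟩

/-- Realized by `(y - V(x)) / (x - c)³`: modulo `uᵢ` the cubic `V` may replace `vᵢ`, so the three
divisors add up to the divisor `(u₁ u₂ u₃, V)` of affine zeros of `y - V(x)`. -/
theorem point_add_point_add_point {p q r : MumfordPair G} {V : k[X]} {κ : k} (hκ : κ ≠ 0)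
    (hV : V.natDegree ≤ 3) (hVG : V ^ 2 - G = C κ * (p.u * q.u * r.u)) (hp : p.u ∣ V - p.v)
    (hq : q.u ∣ V - q.v) (hr : r.u ∣ V - r.v) : M.point p + M.point q + M.point r = 0 := by
  apply Subtype.ext
  change (QuotientAddGroup.mk (M.divisor p + M.divisor q + M.divisor r) : PicardGroup _ _) = 0
  rw [QuotientAddGroup.eq_zero_iff]
  have hcop : ∀ s : MumfordPair G, s.u ∣ V - s.v → IsCoprime s.u V := by
    rintro s ⟨t, ht⟩
    rw [show V = s.v + s.u * t by rw [← ht]; ring]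
    exact s.isCoprime.add_mul_left_right t
  set φ := mapRingHom (algebraMap k (AlgebraicClosure k))
  set p' := p.map (AlgebraicClosure k)
  set q' := q.map (AlgebraicClosure k)
  set r' := r.map (AlgebraicClosure k)
  have hc : IsCoprime (p'.u * q'.u * r'.u) (φ V) := by
    have := (((hcop p hp).mul_left (hcop q hq)).mul_left (hcop r hr)).map φ
    rwa [map_mul, map_mul] at this
  have hdeg : (p'.u * q'.u * r'.u).natDegree = 6 := by
    rw [(p'.monic.mul q'.monic).natDegree_mul r'.monic, p'.monic.natDegree_mul q'.monic,
      p'.natDegree_eq, q'.natDegree_eq, r'.natDegree_eq]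
  have hUV : φ V ^ 2 - φ G = C (algebraMap k (AlgebraicClosure k) κ) * (p'.u * q'.u * r'.u) := by
    rw [← map_pow, ← map_sub, hVG, map_mul, map_mul, map_mul]
    congr 1
    exact map_C _
  have hne : y - aeval x (φ V) ≠ 0 := by
    intro h0
    have := M.isModel.eq_zero_of_add_mul_eq_zero M.squarefree M.natDegree_map_pos (a := -φ V)
      (b := 1) (by rw [map_neg, map_one, one_mul, ← h0]; ring)
    exact one_ne_zero this.2
  have hcc := M.isModel.sub_algebraMap_ne_zero (algebraMap k (AlgebraicClosure k) c)
  refine ⟨_, div_ne_zero hne (pow_ne_zero 3 hcc), fun P => ?_⟩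
  rw [← M.isModel.mumfordOrd_eq_ord M.squarefree M.natDegree_map_eq (by simpa using hκ) hdeg
    (V := φ V) (natDegree_map_le.trans hV) hUV hc,
    M.isModel.mumfordOrd_mul (mul_ne_zero p'.monic.ne_zero q'.monic.ne_zero) r'.monic.ne_zero,
    M.isModel.mumfordOrd_mul p'.monic.ne_zero q'.monic.ne_zero, Finsupp.add_apply,
    Finsupp.add_apply, divisor_apply, divisor_apply, divisor_apply]
  have hd : ∀ s : MumfordPair G, s.u ∣ V - s.v →
      (s.map (AlgebraicClosure k)).u ∣ φ V - (s.map (AlgebraicClosure k)).v := by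
    intro s hs
    have := map_dvd φ hs
    rwa [map_sub] at this
  rw [mumfordOrd_congr (hd p hp), mumfordOrd_congr (hd q hq), mumfordOrd_congr (hd r hr)]
  ring

theorem point_add_conj (p : MumfordPair G) : M.point p + M.point p.conj = 0 := by
  apply Subtype.ext
  change (QuotientAddGroup.mk (M.divisor p + M.divisor p.conj) : PicardGroup _ _) = 0
  rw [QuotientAddGroup.eq_zero_iff]
  set p' := p.map (AlgebraicClosure k)
  have hcc := M.isModel.sub_algebraMap_ne_zero (algebraMap k (AlgebraicClosure k) c)
  refine ⟨_, div_ne_zero (M.isModel.aeval_ne_zero p'.monic.ne_zero) (pow_ne_zero 2 hcc),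
    fun P => ?_⟩
  rw [← M.isModel.mumfordOrd_add_neg p'.monic.ne_zero p'.natDegree_eq p'.dvd p'.isCoprime,
    Finsupp.add_apply, divisor_apply, divisor_apply]
  have h1 : (p.conj.map (AlgebraicClosure k)).u = p'.u := rfl
  have h2 : (p.conj.map (AlgebraicClosure k)).v = -p'.v := Polynomial.map_neg _
  rw [h1, h2]
  ring

theorem nsmul_point_ne_zero (p : MumfordPair G) {m : ℕ} (hm0 : m ≠ 0) (hm : m ≤ 2) :
    m • M.point p ≠ 0 := by
  intro h0
  have h1 : (QuotientAddGroup.mk (m • M.divisor p) : PicardGroup _ _) = 0 := congrArg Subtype.val h0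
  rw [QuotientAddGroup.eq_zero_iff] at h1
  obtain ⟨f, hf0, hf⟩ := h1
  set p' := p.map (AlgebraicClosure k)
  refine M.isModel.ord_ne_mul_mumfordOrd_sub M.squarefree M.natDegree_map_eq p'.natDegree_eq p'.dvd
    p'.isCoprime hm0 hm hf0 (c := algebraMap k (AlgebraicClosure k) c) fun P => ?_
  rw [← hf, Finsupp.smul_apply, divisor_apply, nsmul_eq_mul]

end RationalModel

end GenusTwoCurve

/-! ### Group theory behind the order `48` -/

/-- The first three relations give `a₂ = -2a₁`, `a₄ = -4a₁`, `a₆ = -6a₁`, so the fourth reads `12a₁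
+ 4a₁ = 0`. As `8a₁ = -2a₄ ≠ 0`, `a₁` has order `16`. Passing through `6a₁` makes every nonvanishing
needed a statement about at most twice a Mumford class. -/
theorem addOrderOf_add_eq_48 {A : Type*} [AddCommGroup A] {a₁ a₂ a₄ a₆ b : A}
    (h₂ : a₁ + a₁ + a₂ = 0) (h₄ : -a₂ + -a₂ + a₄ = 0) (h₆ : -a₄ + -a₂ + a₆ = 0)
    (h : -a₆ + -a₆ + -a₄ = 0) (hb : b + b + b = 0) (ha0 : 2 • a₄ ≠ 0) (hb0 : b ≠ 0) :
    addOrderOf (a₁ + b) = 48 := by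
  have e₂ : a₂ = -(2 • a₁) := by
    rw [← neg_eq_of_add_eq_zero_right h₂]; abel
  have e₄ : a₄ = -(4 • a₁) := by
    rw [← neg_eq_of_add_eq_zero_right h₄, e₂]; abel
  have e₆ : a₆ = -(6 • a₁) := by
    rw [← neg_eq_of_add_eq_zero_right h₆, e₂, e₄]; abel
  have e₁₆ : 16 • a₁ = 0 := by
    rw [← h, e₄, e₆]; abel
  have e₃ : 3 • b = 0 := by
    rw [← hb]; abel
  refine addOrderOf_eq_of_nsmul_and_div_prime_nsmul (by norm_num) ?_ ?_
  · rw [show 48 • (a₁ + b) = 3 • (16 • a₁) + 16 • (3 • b) by abel, e₁₆, e₃, smul_zero, smul_zero,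
      add_zero]
  · intro p hp hdvd
    have hp' : p = 2 ∨ p = 3 := by
      rw [show 48 = 2 ^ 4 * 3 by norm_num, hp.dvd_mul] at hdvd
      rcases hdvd with hd | hd
      · exact Or.inl ((Nat.prime_dvd_prime_iff_eq hp Nat.prime_two).1 (hp.dvd_of_dvd_pow hd))
      · exact Or.inr ((Nat.prime_dvd_prime_iff_eq hp Nat.prime_three).1 hd)
    rcases hp' with rfl | rfl
    -- `24(a₁ + b) = 24a₁ = 8a₁ = -2a₄`.
    · intro h0
      apply ha0
      have h24 : 24 • (a₁ + b) = 0 := h0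
      calc 2 • a₄ = 16 • a₁ + 8 • (3 • b) - 24 • (a₁ + b) := by rw [e₄]; abel
        _ = 0 := by rw [h24, e₁₆, e₃]; simp
    -- `16(a₁ + b) = 16b = b`.
    · intro h0
      apply hb0
      have h16 : 16 • (a₁ + b) = 0 := h0
      calc b = 16 • (a₁ + b) - 16 • a₁ - 5 • (3 • b) := by abel
        _ = 0 := by rw [h16, e₁₆, e₃]; simp

/-! ### Completing the square: the model `w² = h² + 4af` of a genus-two curve -/

namespace GenusTwoCurve

variable {k : Type*} [Field k] (X₀ : GenusTwoCurve k)

/-- The polynomial `h² + 4af`. -/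
def disc : k[X] := X₀.h ^ 2 + C (4 * X₀.a) * X₀.f

/-- The function `x`. -/
def x : X₀.FunctionField := algebraMap X₀.CoordinateRing _ (AdjoinRoot.of _ X)

/-- The function `y`. -/
def y : X₀.FunctionField := algebraMap X₀.CoordinateRing _ (AdjoinRoot.root _)

/-- The function `2ay + h(x)`, whose square is `h² + 4af`. -/
def w : X₀.FunctionField := aeval X₀.x (C (2 * X₀.a)) * X₀.y + aeval X₀.x X₀.h

theorem algebraMap_of (p : k[X]) :
    algebraMap X₀.CoordinateRing X₀.FunctionField (AdjoinRoot.of _ p) = aeval X₀.x p := by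
  have h1 : (aeval X₀.x : k[X] →ₐ[k] X₀.FunctionField) p
      = ((IsScalarTower.toAlgHom k X₀.CoordinateRing X₀.FunctionField).comp
        (AdjoinRoot.ofAlgHom k X₀.eqn)) p := by
    congr 1
    ext
    simp [x]
  rw [h1]
  rfl

theorem equation :
    aeval X₀.x (C X₀.a) * X₀.y ^ 2 + aeval X₀.x X₀.h * X₀.y = aeval X₀.x X₀.f := by
  have h1 : AdjoinRoot.mk X₀.eqn (C (C X₀.a) * X ^ 2 + C X₀.h * X - C X₀.f) = 0 :=
    AdjoinRoot.mk_self
  have h2 := congrArg (algebraMap X₀.CoordinateRing X₀.FunctionField) h1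
  simp only [map_sub, map_add, map_mul, map_pow, AdjoinRoot.mk_C, AdjoinRoot.mk_X, map_zero,
    algebraMap_of] at h2
  exact sub_eq_zero.1 h2

/-- The defining equation has degree two in `Y`, so it divides no nonzero polynomial in `X` alone.
-/
theorem transcendental_x : Transcendental k X₀.x := by
  rw [transcendental_iff_injective, injective_iff_map_eq_zero]
  intro p hp
  rw [← algebraMap_of, map_eq_zero_iff _ (IsFractionRing.injective _ _)] at hp
  have h1 : X₀.eqn ∣ C p := AdjoinRoot.mk_eq_zero.1 hp
  by_contra h0
  have h2 := natDegree_le_of_dvd h1 (C_ne_zero.2 h0)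
  have h3 : X₀.eqn.natDegree = 2 := by
    have := X₀.a_ne_zero
    rw [eqn]
    compute_degree!
  rw [h3, natDegree_C] at h2
  omega

theorem isModel [NeZero (2 : k)] : IsModel X₀.disc X₀.x X₀.w where
  transcendental := X₀.transcendental_x
  sq_eq := by
    have := X₀.equation
    simp only [disc, w, map_add, map_mul, map_pow, aeval_C, map_ofNat] at this ⊢
    linear_combination 4 * algebraMap k X₀.FunctionField X₀.a * this
  adjoin_eq_top := by
    set L := IntermediateField.adjoin k {X₀.x, X₀.w}
    have hx : X₀.x ∈ L := IntermediateField.subset_adjoin _ _ (by simp)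
    have hw : X₀.w ∈ L := IntermediateField.subset_adjoin _ _ (by simp)
    have hp : ∀ p : k[X], aeval X₀.x p ∈ L := fun p => by
      have := aeval_mem_adjoin_singleton k X₀.x (p := p)
      exact Algebra.adjoin_le (S := L.toSubalgebra) (by simpa using hx) this
    have hy : X₀.y ∈ L := by
      have h2 : aeval X₀.x (C (2 * X₀.a)) ≠ 0 := by
        rw [aeval_C, Ne, map_eq_zero]
        exact mul_ne_zero two_ne_zero X₀.a_ne_zero
      have : X₀.y = (X₀.w - aeval X₀.x X₀.h) / aeval X₀.x (C (2 * X₀.a)) := by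
        rw [eq_div_iff h2, w]
        ring
      rw [this]
      exact div_mem (sub_mem hw (hp _)) (hp _)
    have hr : ∀ r : X₀.CoordinateRing, algebraMap _ X₀.FunctionField r ∈ L := fun r => by
      obtain ⟨p, rfl⟩ := AdjoinRoot.mk_surjective r
      induction p using Polynomial.induction_on' with
      | add p q hp hq =>
        rw [map_add, map_add]
        exact add_mem hp hq
      | monomial n a =>
        rw [← C_mul_X_pow_eq_monomial, map_mul, map_mul, map_pow, map_pow, AdjoinRoot.mk_C,
          AdjoinRoot.mk_X, algebraMap_of]
        exact mul_mem (hp a) (pow_mem hy n)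
    rw [eq_top_iff]
    rintro z -
    obtain ⟨r, s, -, rfl⟩ := IsFractionRing.div_surjective (A := X₀.CoordinateRing) z
    exact div_mem (hr r) (hr s)

/-- An isomorphism is thus reduced to finding, in the function field of one curve, generators that
satisfy the sextic equation of the other. -/
theorem isomorphic_of_isModel [NeZero (2 : k)] {X₀ X₁ : GenusTwoCurve k} {x' y' : X₀.FunctionField}
    (h : IsModel X₁.disc x' y') : X₀.Isomorphic X₁ := by
  obtain ⟨e, -⟩ := h.exists_algEquiv X₁.isModel X₁.separable.squarefree
    (lt_of_lt_of_le (by norm_num) X₁.five_le_natDegree)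
  exact ⟨e⟩

theorem disc_baseChange (L : Type*) [Field L] [Algebra k L] :
    (X₀.baseChange L).disc = X₀.disc.map (algebraMap k L) :=
  X₀.map_discriminant.symm

section Galois

variable {L : Type*} [Field L] [Algebra k L] (σ : L ≃ₐ[k] L)

theorem galoisFunctionField_x :
    X₀.galoisFunctionField σ (X₀.baseChange L).x = (X₀.baseChange L).x := by
  rw [x, galoisFunctionField, IsFractionRing.ringEquivOfRingEquiv_algebraMap]
  congr 1
  simp [galoisCoordinateRing]

theorem galoisFunctionField_y :
    X₀.galoisFunctionField σ (X₀.baseChange L).y = (X₀.baseChange L).y := by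
  rw [y, galoisFunctionField, IsFractionRing.ringEquivOfRingEquiv_algebraMap]
  congr 1
  simp [galoisCoordinateRing]

theorem galoisFunctionField_w :
    X₀.galoisFunctionField σ (X₀.baseChange L).w = (X₀.baseChange L).w := by
  have h1 := X₀.galoisFunctionField_aeval σ (X₀.galoisFunctionField_x σ) (C (2 * X₀.a))
  have h2 := X₀.galoisFunctionField_aeval σ (X₀.galoisFunctionField_x σ) X₀.h
  have h3 : (X₀.baseChange L).w
      = aeval (X₀.baseChange L).x ((C (2 * X₀.a)).map (algebraMap k L)) * (X₀.baseChange L).y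
        + aeval (X₀.baseChange L).x (X₀.h.map (algebraMap k L)) := by
    rw [map_C, map_mul, map_ofNat]
    rfl
  rw [h3, map_add, map_mul, h1, h2, galoisFunctionField_y]

end Galois

theorem rationalModel [CharZero k] (hdeg : X₀.disc.natDegree = 6) {c : k}
    (hc : X₀.disc.eval c ≠ 0) :
    X₀.RationalModel X₀.disc (X₀.baseChange (AlgebraicClosure k)).x
      (X₀.baseChange (AlgebraicClosure k)).w c where
  isModel := by
    have : CharZero (AlgebraicClosure k) := charZero_of_injective_algebraMap (algebraMap k _).injective
    have := (X₀.baseChange (AlgebraicClosure k)).isModel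
    rwa [disc_baseChange] at this
  separable := X₀.separable
  natDegree_eq := hdeg
  map_x := X₀.galoisFunctionField_x
  map_y := X₀.galoisFunctionField_w
  eval_ne_zero := hc

end GenusTwoCurve

/-! ### Collinear triples of Mumford pairs -/

/-- There is a cubic `y = V(x)` which meets `y² = G(x)` in the sum of three divisors of degree
two. -/
def MumfordPair.Collinear {k : Type*} [Field k] {G : k[X]} (p q r : MumfordPair G) : Prop :=
  ∃ (V : k[X]) (κ : k), κ ≠ 0 ∧ V.natDegree ≤ 3 ∧ V ^ 2 - G = C κ * (p.u * q.u * r.u) ∧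
    p.u ∣ V - p.v ∧ q.u ∣ V - q.v ∧ r.u ∣ V - r.v

namespace GenusTwoCurve.RationalModel

variable {k : Type*} [Field k] {X₀ : GenusTwoCurve k} {G : k[X]}
  {x y : (X₀.baseChange (AlgebraicClosure k)).FunctionField} {c : k}

/-- Exchanging `0` and `∞` on the `x`-line makes divisors that involve points at infinity accessible
to Mumford pairs. -/
theorem inv (M : X₀.RationalModel G x y c) {G' : k[X]} {c' : k}
    (hsq : (y / x ^ 3) ^ 2 = aeval x⁻¹ (G'.map (algebraMap k (AlgebraicClosure k))))
    (hG' : G'.Separable) (hdeg : G'.natDegree = 6) (hc' : G'.eval c' ≠ 0) :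
    X₀.RationalModel G' x⁻¹ (y / x ^ 3) c' where
  isModel := by
    have hx : x ≠ 0 := by simpa using M.isModel.sub_algebraMap_ne_zero 0
    refine M.isModel.change hsq ?_ ?_
    · simpa using inv_mem (IntermediateField.mem_adjoin_simple_self (AlgebraicClosure k) x⁻¹)
    · have h1 : x⁻¹ ∈ IntermediateField.adjoin (AlgebraicClosure k) {x⁻¹, y / x ^ 3} :=
        IntermediateField.subset_adjoin _ _ (by simp)
      have h2 : y / x ^ 3 ∈ IntermediateField.adjoin (AlgebraicClosure k) {x⁻¹, y / x ^ 3} :=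
        IntermediateField.subset_adjoin _ _ (by simp)
      have h3 := div_mem h2 (pow_mem h1 3)
      rwa [inv_pow, div_inv_eq_mul, div_mul_cancel₀ _ (pow_ne_zero 3 hx)] at h3
  separable := hG'
  natDegree_eq := hdeg
  map_x σ := (map_inv₀ (X₀.galoisFunctionField σ) x).trans (congrArg _ (M.map_x σ))
  map_y σ := (map_div₀ (X₀.galoisFunctionField σ) y (x ^ 3)).trans (by
    rw [M.map_y, map_pow, M.map_x])
  eval_ne_zero := hc'

variable [CharZero k]

theorem point_add_of_collinear (M : X₀.RationalModel G x y c) {p q r : MumfordPair G}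
    (h : p.Collinear q r) : M.point p + M.point q + M.point r = 0 := by
  obtain ⟨V, κ, hκ, hV, hVG, hp, hq, hr⟩ := h
  exact M.point_add_point_add_point hκ hV hVG hp hq hr

theorem point_conj (M : X₀.RationalModel G x y c) (p : MumfordPair G) :
    M.point p.conj = -M.point p :=
  (neg_eq_of_add_eq_zero_right (M.point_add_conj p)).symm

theorem exists_addOrderOf_eq_48 (M : X₀.RationalModel G x y c) {a₁ a₂ a₄ a₆ b : MumfordPair G}
    (h₂ : a₁.Collinear a₁ a₂) (h₄ : a₂.conj.Collinear a₂.conj a₄)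
    (h₆ : a₄.conj.Collinear a₂.conj a₆) (h : a₆.conj.Collinear a₆.conj a₄.conj)
    (hb : b.Collinear b b) : ∃ P : X₀.jacobianPoints, addOrderOf P = 48 := by
  have e₂ := M.point_add_of_collinear h₂
  have e₄ := M.point_add_of_collinear h₄
  have e₆ := M.point_add_of_collinear h₆
  have e := M.point_add_of_collinear h
  simp only [point_conj] at e₄ e₆ e
  refine ⟨_, addOrderOf_add_eq_48 e₂ e₄ e₆ e (M.point_add_of_collinear hb)
    (M.nsmul_point_ne_zero a₄ two_ne_zero le_rfl) ?_⟩
  have := M.nsmul_point_ne_zero b one_ne_zero one_le_two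
  rwa [one_smul] at this

end GenusTwoCurve.RationalModel

/-! ### The first curve -/

/-- The polynomial `h² + 4f` of the first curve. -/
def firstDisc : ℚ[X] :=
  C 4 * X ^ 6 + C (-12) * X ^ 5 + C (-19) * X ^ 4 + C 58 * X ^ 3 + C 33 * X ^ 2 + C (-64) * X

/-- Explicit Bézout coefficients for the sextic and its derivative; the other sextics are treated in
the same way. -/
theorem firstDisc_separable : firstDisc.Separable := by
  have hd : derivative firstDisc = C 24 * X ^ 5 + C (-60) * X ^ 4 + C (-76) * X ^ 3 + C 174 * X ^ 2 + C 66 * X + C (-64) :=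
    Polynomial.funext fun r => by
      simp [firstDisc]
      ring
  rw [separable_def, hd]
  exact ⟨C (-61 / 8064) * X ^ 4 + C (61 / 4032) * X ^ 3 + C (4787 / 96768) * X ^ 2 + C (-5519 /
      96768) * X + C (-7901 / 193536),
    C (61 / 48384) * X ^ 5 + C (-305 / 96768) * X ^ 4 + C (-227 / 21504) * X ^ 3 + C (7349 /
      387072) * X ^ 2 + C (9565 / 387072) * X + C (-1 / 64),
    Polynomial.funext fun r => by
      simp only [firstDisc, eval_one, eval_add, eval_mul, eval_pow, eval_C, eval_X]
      ring⟩

theorem firstDisc_natDegree : firstDisc.natDegree = 6 := by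
  rw [firstDisc]
  compute_degree!

theorem firstDisc_eq : (X ^ 2 + X) ^ 2 + C (4 * 1) * sextic 0 = firstDisc :=
  Polynomial.funext fun r => by
    simp [sextic, firstDisc]
    ring

/-- The first curve. -/
def firstCurve : GenusTwoCurve ℚ where
  a := 1
  h := X ^ 2 + X
  f := sextic 0
  a_ne_zero := one_ne_zero
  natDegree_h_le := by compute_degree!
  natDegree_f_le := by
    simp only [sextic, Matrix.cons_val]
    compute_degree
  separable := by
    rw [firstDisc_eq]
    exact firstDisc_separable
  five_le_natDegree := by
    rw [firstDisc_eq, firstDisc_natDegree]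
    norm_num

theorem firstCurve_rationalModel :
    firstCurve.RationalModel firstDisc (firstCurve.baseChange (AlgebraicClosure ℚ)).x
      (firstCurve.baseChange (AlgebraicClosure ℚ)).w (-1) := by
  have hdisc : firstCurve.disc = firstDisc := firstDisc_eq
  rw [← hdisc]
  apply GenusTwoCurve.rationalModel
  · rw [hdisc, firstDisc_natDegree]
  -- The fibre is taken over `-1` because `0` is a root of the sextic; its value at `-1` is `36`.
  · rw [hdisc]
    norm_num [firstDisc]

/-- A divisor whose class has order `16`. -/
def firstPair₁ : MumfordPair firstDisc where
  u := X ^ 2 + C (-3 / 2) * X + C (-4)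
  v := C 3 * X
  monic := by monicity!
  natDegree_eq := by compute_degree!
  dvd := ⟨C (-4) * X ^ 4 + C 6 * X ^ 3 + C 12 * X ^ 2 + C (-16) * X, Polynomial.funext fun r => by
      simp only [firstDisc, eval_sub, eval_add, eval_mul, eval_pow, eval_C, eval_X]
      ring⟩
  isCoprime := ⟨C (-1 / 4), C (1 / 12) * X + C (-1 / 8),
    Polynomial.funext fun r => by
      simp only [eval_one, eval_add, eval_mul, eval_pow, eval_C, eval_X]
      ring⟩

/-- A divisor whose class is `-2` times that of `firstPair₁`. -/
def firstPair₂ : MumfordPair firstDisc where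
  u := X ^ 2 + C (-1) * X + C (-2)
  v := C (-6)
  monic := by monicity!
  natDegree_eq := by compute_degree!
  dvd := ⟨C (-4) * X ^ 4 + C 8 * X ^ 3 + C 19 * X ^ 2 + C (-23) * X + C (-18), Polynomial.funext fun r => by
      simp only [firstDisc, eval_sub, eval_add, eval_mul, eval_pow, eval_C, eval_X]
      ring⟩
  isCoprime := ⟨0, C (-1 / 6),
    Polynomial.funext fun r => by
      simp only [eval_one, eval_zero, eval_add, eval_mul, eval_pow, eval_C, eval_X]
      ring⟩

/-- A divisor whose class is `-4` times that of `firstPair₁`. -/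
def firstPair₄ : MumfordPair firstDisc where
  u := X ^ 2 + C (-1) * X + C (-4)
  v := C 4
  monic := by monicity!
  natDegree_eq := by compute_degree!
  dvd := ⟨C (-4) * X ^ 4 + C 8 * X ^ 3 + C 11 * X ^ 2 + C (-15) * X + C (-4), Polynomial.funext fun r => by
      simp only [firstDisc, eval_sub, eval_add, eval_mul, eval_pow, eval_C, eval_X]
      ring⟩
  isCoprime := ⟨0, C (1 / 4),
    Polynomial.funext fun r => by
      simp only [eval_one, eval_zero, eval_add, eval_mul, eval_pow, eval_C, eval_X]
      ring⟩

/-- A divisor whose class is `-6` times that of `firstPair₁`. -/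
def firstPair₆ : MumfordPair firstDisc where
  u := X ^ 2 + C (-1) * X + C (-8)
  v := C (-24)
  monic := by monicity!
  natDegree_eq := by compute_degree!
  dvd := ⟨C (-4) * X ^ 4 + C 8 * X ^ 3 + C (-5) * X ^ 2 + X + C (-72), Polynomial.funext fun r => by
      simp only [firstDisc, eval_sub, eval_add, eval_mul, eval_pow, eval_C, eval_X]
      ring⟩
  isCoprime := ⟨0, C (-1 / 24),
    Polynomial.funext fun r => by
      simp only [eval_one, eval_zero, eval_add, eval_mul, eval_pow, eval_C, eval_X]
      ring⟩

/-- A divisor whose class has order `3`. -/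
def firstPairThree : MumfordPair firstDisc where
  u := X ^ 2 + C (-1) * X + C (-2)
  v := C 4 * X + C (-2)
  monic := by monicity!
  natDegree_eq := by compute_degree!
  dvd := ⟨C (-4) * X ^ 4 + C 8 * X ^ 3 + C 19 * X ^ 2 + C (-23) * X + C (-2), Polynomial.funext fun r => by
      simp only [firstDisc, eval_sub, eval_add, eval_mul, eval_pow, eval_C, eval_X]
      ring⟩
  isCoprime := ⟨C (-4 / 9), C (1 / 9) * X + C (-1 / 18),
    Polynomial.funext fun r => by
      simp only [eval_one, eval_add, eval_mul, eval_pow, eval_C, eval_X]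
      ring⟩

/-- `firstPair₁` is not invariant under `X ↦ 1 - X`, so its double needs a genuine cubic, with `V ≡
v` modulo `u` and `V² ≡ G` modulo `u²`. The constant `κ` is the difference `(2/3)² - 4` of leading
coefficients. -/
theorem firstPair_collinear₂ : MumfordPair.Collinear firstPair₁ firstPair₁ firstPair₂ :=
  ⟨C (2 / 3) * X ^ 3 + C (5 / 3) * X ^ 2 + C (-11 / 3) * X + C (-32 / 3), (-32 / 9), by norm_num, by compute_degree!,
    Polynomial.funext fun r => by
      simp only [firstDisc, firstPair₁, firstPair₂, eval_sub, eval_add, eval_mul, eval_pow, eval_C, eval_X]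
      ring,
    ⟨C (2 / 3) * X + C (8 / 3), Polynomial.funext fun r => by
      simp only [firstPair₁, eval_sub, eval_add, eval_mul, eval_pow, eval_C, eval_X]
      ring⟩,
    ⟨C (2 / 3) * X + C (8 / 3), Polynomial.funext fun r => by
      simp only [firstPair₁, eval_sub, eval_add, eval_mul, eval_pow, eval_C, eval_X]
      ring⟩,
    ⟨C (2 / 3) * X + C (7 / 3), Polynomial.funext fun r => by
      simp only [firstPair₂, eval_sub, eval_add, eval_mul, eval_pow, eval_C, eval_X]
      ring⟩⟩

/-- With `t = X² - X` the sextic is `4t³ - 31t² + 64t`. The polynomial `V = 8 - t` is the tangent at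
`(2, 6)` to the elliptic curve `w² = 4t³ - 31t² + 64t`; it meets the curve again at `(4, 4)`. -/
theorem firstPair_collinear₄ : MumfordPair.Collinear firstPair₂.conj firstPair₂.conj firstPair₄ :=
  ⟨C (-1) * X ^ 2 + X + C 8, (-4), by norm_num, by compute_degree!,
    Polynomial.funext fun r => by
      simp only [firstDisc, MumfordPair.conj, firstPair₂, firstPair₄, eval_sub, eval_add, eval_mul, eval_pow, eval_C, eval_X]
      ring,
    ⟨C (-1), Polynomial.funext fun r => by
      simp only [MumfordPair.conj, firstPair₂, eval_sub, eval_neg, eval_add, eval_mul, eval_pow, eval_C, eval_X]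
      ring⟩,
    ⟨C (-1), Polynomial.funext fun r => by
      simp only [MumfordPair.conj, firstPair₂, eval_sub, eval_neg, eval_add, eval_mul, eval_pow, eval_C, eval_X]
      ring⟩,
    ⟨C (-1), Polynomial.funext fun r => by
      simp only [firstPair₄, eval_sub, eval_add, eval_mul, eval_pow, eval_C, eval_X]
      ring⟩⟩

/-- The chord `16 - 5t` through `(4, -4)` and `(2, 6)`, with third point `(8, -24)`. -/
theorem firstPair_collinear₆ : MumfordPair.Collinear firstPair₄.conj firstPair₂.conj firstPair₆ :=
  ⟨C (-5) * X ^ 2 + C 5 * X + C 16, (-4), by norm_num, by compute_degree!,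
    Polynomial.funext fun r => by
      simp only [firstDisc, MumfordPair.conj, firstPair₂, firstPair₄, firstPair₆, eval_sub, eval_add, eval_mul, eval_pow, eval_C, eval_X]
      ring,
    ⟨C (-5), Polynomial.funext fun r => by
      simp only [MumfordPair.conj, firstPair₄, eval_sub, eval_neg, eval_add, eval_mul, eval_pow, eval_C, eval_X]
      ring⟩,
    ⟨C (-5), Polynomial.funext fun r => by
      simp only [MumfordPair.conj, firstPair₂, eval_sub, eval_neg, eval_add, eval_mul, eval_pow, eval_C, eval_X]
      ring⟩,
    ⟨C (-5), Polynomial.funext fun r => by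
      simp only [firstPair₆, eval_sub, eval_add, eval_mul, eval_pow, eval_C, eval_X]
      ring⟩⟩

/-- The tangent `7t - 32` at `(8, 24)` returns to `(4, -4)`; this closes the chain. -/
theorem firstPair_collinear_last : MumfordPair.Collinear firstPair₆.conj firstPair₆.conj firstPair₄.conj :=
  ⟨C 7 * X ^ 2 + C (-7) * X + C (-32), (-4), by norm_num, by compute_degree!,
    Polynomial.funext fun r => by
      simp only [firstDisc, MumfordPair.conj, firstPair₄, firstPair₆, eval_sub, eval_add, eval_mul, eval_pow, eval_C, eval_X]
      ring,
    ⟨C 7, Polynomial.funext fun r => by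
      simp only [MumfordPair.conj, firstPair₆, eval_sub, eval_neg, eval_add, eval_mul, eval_pow, eval_C, eval_X]
      ring⟩,
    ⟨C 7, Polynomial.funext fun r => by
      simp only [MumfordPair.conj, firstPair₆, eval_sub, eval_neg, eval_add, eval_mul, eval_pow, eval_C, eval_X]
      ring⟩,
    ⟨C 7, Polynomial.funext fun r => by
      simp only [MumfordPair.conj, firstPair₄, eval_sub, eval_neg, eval_add, eval_mul, eval_pow, eval_C, eval_X]
      ring⟩⟩

/-- Here `v` and `V` change sign under `X ↦ 1 - X`: the class comes from the quotient by `(X, w) ↦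
(1 - X, -w)`. The cubic meets the curve in three times the same divisor. -/
theorem firstPairThree_collinear : MumfordPair.Collinear firstPairThree firstPairThree firstPairThree :=
  ⟨C (-14 / 9) * X ^ 3 + C (7 / 3) * X ^ 2 + C (19 / 3) * X + C (-32 / 9), (-128 / 81), by norm_num, by compute_degree!,
    Polynomial.funext fun r => by
      simp only [firstDisc, firstPairThree, eval_sub, eval_add, eval_mul, eval_pow, eval_C, eval_X]
      ring,
    ⟨C (-14 / 9) * X + C (7 / 9), Polynomial.funext fun r => by
      simp only [firstPairThree, eval_sub, eval_add, eval_mul, eval_pow, eval_C, eval_X]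
      ring⟩,
    ⟨C (-14 / 9) * X + C (7 / 9), Polynomial.funext fun r => by
      simp only [firstPairThree, eval_sub, eval_add, eval_mul, eval_pow, eval_C, eval_X]
      ring⟩,
    ⟨C (-14 / 9) * X + C (7 / 9), Polynomial.funext fun r => by
      simp only [firstPairThree, eval_sub, eval_add, eval_mul, eval_pow, eval_C, eval_X]
      ring⟩⟩

theorem firstCurve_exists_addOrderOf_eq_48 :
    ∃ P : firstCurve.jacobianPoints, addOrderOf P = 48 :=
  firstCurve_rationalModel.exists_addOrderOf_eq_48 firstPair_collinear₂ firstPair_collinear₄ firstPair_collinear₆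
    firstPair_collinear_last firstPairThree_collinear

/-! ### The second curve -/

/-- The polynomial `h² + 4f` of the second curve. -/
def secondDisc : ℚ[X] :=
  C 4 * X ^ 6 + C (-4) * X ^ 5 + C 21 * X ^ 4 + C (-42) * X ^ 3 + C 41 * X ^ 2 + C (-24) * X + C
  8

theorem secondDisc_separable : secondDisc.Separable := by
  have hd : derivative secondDisc = C 24 * X ^ 5 + C (-20) * X ^ 4 + C 84 * X ^ 3 + C (-126) * X ^ 2 + C 82 * X + C (-24) :=
    Polynomial.funext fun r => by
      simp [secondDisc]
      ring
  rw [separable_def, hd]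
  exact ⟨C (13 / 576) * X ^ 4 + C (3103 / 24192) * X ^ 3 + C (1205 / 6048) * X ^ 2 + C (20819 /
      48384) * X + C (71 / 576),
    C (-13 / 3456) * X ^ 5 + C (-251 / 12096) * X ^ 4 + C (-3455 / 96768) * X ^ 3 + C (-8527 /
      96768) * X ^ 2 + C (55 / 3024) * X + C (-1 / 1728),
    Polynomial.funext fun r => by
      simp only [secondDisc, eval_one, eval_add, eval_mul, eval_pow, eval_C, eval_X]
      ring⟩

theorem secondDisc_natDegree : secondDisc.natDegree = 6 := by
  rw [secondDisc]
  compute_degree!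

theorem secondDisc_eq : (X ^ 2 + X) ^ 2 + C (4 * 1) * sextic 1 = secondDisc :=
  Polynomial.funext fun r => by
    simp [sextic, secondDisc]
    ring

/-- The second curve. -/
def secondCurve : GenusTwoCurve ℚ where
  a := 1
  h := X ^ 2 + X
  f := sextic 1
  a_ne_zero := one_ne_zero
  natDegree_h_le := by compute_degree!
  natDegree_f_le := by
    simp only [sextic, Matrix.cons_val]
    compute_degree
  separable := by
    rw [secondDisc_eq]
    exact secondDisc_separable
  five_le_natDegree := by
    rw [secondDisc_eq, secondDisc_natDegree]
    norm_num

/-- The reverse of `h² + 4f` for the second curve. -/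
def secondDiscReverse : ℚ[X] :=
  C 8 * X ^ 6 + C (-24) * X ^ 5 + C 41 * X ^ 4 + C (-42) * X ^ 3 + C 21 * X ^ 2 + C (-4) * X + C
  4

theorem secondDiscReverse_separable : secondDiscReverse.Separable := by
  have hd : derivative secondDiscReverse = C 48 * X ^ 5 + C (-120) * X ^ 4 + C 164 * X ^ 3 + C (-126) * X ^ 2 + C 42 * X + C (-4) :=
    Polynomial.funext fun r => by
      simp [secondDiscReverse]
      ring
  rw [separable_def, hd]
  exact ⟨C (-37 / 1008) * X ^ 4 + C (37 / 504) * X ^ 3 + C (83 / 1512) * X ^ 2 + C (-277 / 3024) *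
      X + C (13507 / 48384),
    C (37 / 6048) * X ^ 5 + C (-185 / 12096) * X ^ 4 + C (-11 / 48384) * X ^ 3 + C (1513 /
      96768) * X ^ 2 + C (-6247 / 96768) * X + C (1411 / 48384),
    Polynomial.funext fun r => by
      simp only [secondDiscReverse, eval_one, eval_add, eval_mul, eval_pow, eval_C, eval_X]
      ring⟩

theorem secondCurve_rationalModel_disc :
    secondCurve.RationalModel secondDisc (secondCurve.baseChange (AlgebraicClosure ℚ)).x
      (secondCurve.baseChange (AlgebraicClosure ℚ)).w 0 := by
  have hdisc : secondCurve.disc = secondDisc := secondDisc_eq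
  rw [← hdisc]
  apply GenusTwoCurve.rationalModel
  · rw [hdisc, secondDisc_natDegree]
  · rw [hdisc]
    norm_num [secondDisc]

theorem sq_eq_of_secondDisc {K F : Type*} [Field K] [Field F] [Algebra K F] [Algebra ℚ K]
    {x w : F} (h : IsModel (secondDisc.map (algebraMap ℚ K)) x w) :
    (w / x ^ 3) ^ 2 = aeval x⁻¹ (secondDiscReverse.map (algebraMap ℚ K)) := by
  have hx : x ≠ 0 := by simpa using h.sub_algebraMap_ne_zero 0
  rw [div_pow, h.sq_eq, div_eq_iff (pow_ne_zero 2 (pow_ne_zero 3 hx))]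
  simp only [secondDisc, secondDiscReverse, Polynomial.map_add, Polynomial.map_mul,
    Polynomial.map_pow, map_X, Polynomial.map_C, map_add, map_mul, map_pow, aeval_X, aeval_C]
  simp only [map_neg, map_ofNat]
  field_simp
  ring

/-- The coordinate `x⁻¹` is used because `secondPair₄` contains a point over `x⁻¹ = 0`, which is at
infinity in the original model, and because the reversed sextic is the one invariant under `X ↦ 1 -
X`. -/
theorem secondCurve_rationalModel :
    secondCurve.RationalModel secondDiscReverse
      (secondCurve.baseChange (AlgebraicClosure ℚ)).x⁻¹
      ((secondCurve.baseChange (AlgebraicClosure ℚ)).w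
        / (secondCurve.baseChange (AlgebraicClosure ℚ)).x ^ 3) 0 := by
  have M := secondCurve_rationalModel_disc
  refine M.inv ?_ secondDiscReverse_separable ?_ ?_
  · exact sq_eq_of_secondDisc M.isModel
  · rw [secondDiscReverse]
    compute_degree!
  · norm_num [secondDiscReverse]

/-- A divisor whose class has order `16`. -/
def secondPair₁ : MumfordPair secondDiscReverse where
  u := X ^ 2 + C (-3) * X + C 2
  v := C 10 * X + C (-8)
  monic := by monicity!
  natDegree_eq := by compute_degree!
  dvd := ⟨C (-8) * X ^ 4 + C (-25) * X ^ 2 + C (-33) * X + C 30, Polynomial.funext fun r => by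
      simp only [secondDiscReverse, eval_sub, eval_add, eval_mul, eval_pow, eval_C, eval_X]
      ring⟩
  isCoprime := ⟨C (25 / 6), C (-5 / 12) * X + C (11 / 12),
    Polynomial.funext fun r => by
      simp only [eval_one, eval_add, eval_mul, eval_pow, eval_C, eval_X]
      ring⟩

/-- A divisor whose class is `-2` times that of `secondPair₁`. -/
def secondPair₂ : MumfordPair secondDiscReverse where
  u := X ^ 2 + C (-1) * X + C (-2)
  v := C 12
  monic := by monicity!
  natDegree_eq := by compute_degree!
  dvd := ⟨C (-8) * X ^ 4 + C 16 * X ^ 3 + C (-41) * X ^ 2 + C 33 * X + C (-70), Polynomial.funext fun r => by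
      simp only [secondDiscReverse, eval_sub, eval_add, eval_mul, eval_pow, eval_C, eval_X]
      ring⟩
  isCoprime := ⟨0, C (1 / 12),
    Polynomial.funext fun r => by
      simp only [eval_one, eval_zero, eval_add, eval_mul, eval_pow, eval_C, eval_X]
      ring⟩

/-- A divisor whose class is `-4` times that of `secondPair₁`. -/
def secondPair₄ : MumfordPair secondDiscReverse where
  u := X ^ 2 + C (-1) * X
  v := C 2
  monic := by monicity!
  natDegree_eq := by compute_degree!
  dvd := ⟨C (-8) * X ^ 4 + C 16 * X ^ 3 + C (-25) * X ^ 2 + C 17 * X + C (-4), Polynomial.funext fun r => by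
      simp only [secondDiscReverse, eval_sub, eval_add, eval_mul, eval_pow, eval_C, eval_X]
      ring⟩
  isCoprime := ⟨0, C (1 / 2),
    Polynomial.funext fun r => by
      simp only [eval_one, eval_zero, eval_add, eval_mul, eval_pow, eval_C, eval_X]
      ring⟩

/-- A divisor whose class is `-6` times that of `secondPair₁`. -/
def secondPair₆ : MumfordPair secondDiscReverse where
  u := X ^ 2 + C (-1) * X + C 1
  v := C 3
  monic := by monicity!
  natDegree_eq := by compute_degree!
  dvd := ⟨C (-8) * X ^ 4 + C 16 * X ^ 3 + C (-17) * X ^ 2 + C 9 * X + C 5, Polynomial.funext fun r => by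
      simp only [secondDiscReverse, eval_sub, eval_add, eval_mul, eval_pow, eval_C, eval_X]
      ring⟩
  isCoprime := ⟨0, C (1 / 3),
    Polynomial.funext fun r => by
      simp only [eval_one, eval_zero, eval_add, eval_mul, eval_pow, eval_C, eval_X]
      ring⟩

/-- A divisor whose class has order `3`. -/
def secondPairThree : MumfordPair secondDiscReverse where
  u := X ^ 2 + C (-1) * X + C (-2)
  v := C 8 * X + C (-4)
  monic := by monicity!
  natDegree_eq := by compute_degree!
  dvd := ⟨C (-8) * X ^ 4 + C 16 * X ^ 3 + C (-41) * X ^ 2 + C 33 * X + C (-6), Polynomial.funext fun r => by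
      simp only [secondDiscReverse, eval_sub, eval_add, eval_mul, eval_pow, eval_C, eval_X]
      ring⟩
  isCoprime := ⟨C (-4 / 9), C (1 / 18) * X + C (-1 / 36),
    Polynomial.funext fun r => by
      simp only [eval_one, eval_add, eval_mul, eval_pow, eval_C, eval_X]
      ring⟩

theorem secondPair_collinear₂ : MumfordPair.Collinear secondPair₁ secondPair₁ secondPair₂ :=
  ⟨C 2 * X ^ 3 + X ^ 2 + C (-7) * X + C 6, (-4), by norm_num, by compute_degree!,
    Polynomial.funext fun r => by
      simp only [secondDiscReverse, secondPair₁, secondPair₂, eval_sub, eval_add, eval_mul, eval_pow, eval_C, eval_X]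
      ring,
    ⟨C 2 * X + C 7, Polynomial.funext fun r => by
      simp only [secondPair₁, eval_sub, eval_add, eval_mul, eval_pow, eval_C, eval_X]
      ring⟩,
    ⟨C 2 * X + C 7, Polynomial.funext fun r => by
      simp only [secondPair₁, eval_sub, eval_add, eval_mul, eval_pow, eval_C, eval_X]
      ring⟩,
    ⟨C 2 * X + C 3, Polynomial.funext fun r => by
      simp only [secondPair₂, eval_sub, eval_add, eval_mul, eval_pow, eval_C, eval_X]
      ring⟩⟩

/-- The reversed sextic is `8t³ + 17t² + 4t + 4` with `t = X² - X`. The tangent `2 - 7t` at `(2,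
-12)` meets `w² = 8t³ + 17t² + 4t + 4` again at `(0, 2)`; the next two relations are a chord and a
tangent of this same curve. -/
theorem secondPair_collinear₄ : MumfordPair.Collinear secondPair₂.conj secondPair₂.conj secondPair₄ :=
  ⟨C (-7) * X ^ 2 + C 7 * X + C 2, (-8), by norm_num, by compute_degree!,
    Polynomial.funext fun r => by
      simp only [secondDiscReverse, MumfordPair.conj, secondPair₂, secondPair₄, eval_sub, eval_add, eval_mul, eval_pow, eval_C, eval_X]
      ring,
    ⟨C (-7), Polynomial.funext fun r => by
      simp only [MumfordPair.conj, secondPair₂, eval_sub, eval_neg, eval_add, eval_mul, eval_pow, eval_C, eval_X]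
      ring⟩,
    ⟨C (-7), Polynomial.funext fun r => by
      simp only [MumfordPair.conj, secondPair₂, eval_sub, eval_neg, eval_add, eval_mul, eval_pow, eval_C, eval_X]
      ring⟩,
    ⟨C (-7), Polynomial.funext fun r => by
      simp only [secondPair₄, eval_sub, eval_add, eval_mul, eval_pow, eval_C, eval_X]
      ring⟩⟩

theorem secondPair_collinear₆ : MumfordPair.Collinear secondPair₄.conj secondPair₂.conj secondPair₆ :=
  ⟨C (-5) * X ^ 2 + C 5 * X + C (-2), (-8), by norm_num, by compute_degree!,
    Polynomial.funext fun r => by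
      simp only [secondDiscReverse, MumfordPair.conj, secondPair₂, secondPair₄, secondPair₆, eval_sub, eval_add, eval_mul, eval_pow, eval_C, eval_X]
      ring,
    ⟨C (-5), Polynomial.funext fun r => by
      simp only [MumfordPair.conj, secondPair₄, eval_sub, eval_neg, eval_add, eval_mul, eval_pow, eval_C, eval_X]
      ring⟩,
    ⟨C (-5), Polynomial.funext fun r => by
      simp only [MumfordPair.conj, secondPair₂, eval_sub, eval_neg, eval_add, eval_mul, eval_pow, eval_C, eval_X]
      ring⟩,
    ⟨C (-5), Polynomial.funext fun r => by
      simp only [secondPair₆, eval_sub, eval_add, eval_mul, eval_pow, eval_C, eval_X]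
      ring⟩⟩

theorem secondPair_collinear_last : MumfordPair.Collinear secondPair₆.conj secondPair₆.conj secondPair₄.conj :=
  ⟨X ^ 2 + C (-1) * X + C (-2), (-8), by norm_num, by compute_degree!,
    Polynomial.funext fun r => by
      simp only [secondDiscReverse, MumfordPair.conj, secondPair₄, secondPair₆, eval_sub, eval_add, eval_mul, eval_pow, eval_C, eval_X]
      ring,
    ⟨C 1, Polynomial.funext fun r => by
      simp only [MumfordPair.conj, secondPair₆, eval_sub, eval_neg, eval_add, eval_mul, eval_pow, eval_C, eval_X]
      ring⟩,
    ⟨C 1, Polynomial.funext fun r => by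
      simp only [MumfordPair.conj, secondPair₆, eval_sub, eval_neg, eval_add, eval_mul, eval_pow, eval_C, eval_X]
      ring⟩,
    ⟨C 1, Polynomial.funext fun r => by
      simp only [MumfordPair.conj, secondPair₄, eval_sub, eval_neg, eval_add, eval_mul, eval_pow, eval_C, eval_X]
      ring⟩⟩

theorem secondPairThree_collinear : MumfordPair.Collinear secondPairThree secondPairThree secondPairThree :=
  ⟨C (26 / 9) * X ^ 3 + C (-13 / 3) * X ^ 2 + C (11 / 3) * X + C (-10 / 9), (28 / 81), by norm_num, by compute_degree!,
    Polynomial.funext fun r => by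
      simp only [secondDiscReverse, secondPairThree, eval_sub, eval_add, eval_mul, eval_pow, eval_C, eval_X]
      ring,
    ⟨C (26 / 9) * X + C (-13 / 9), Polynomial.funext fun r => by
      simp only [secondPairThree, eval_sub, eval_add, eval_mul, eval_pow, eval_C, eval_X]
      ring⟩,
    ⟨C (26 / 9) * X + C (-13 / 9), Polynomial.funext fun r => by
      simp only [secondPairThree, eval_sub, eval_add, eval_mul, eval_pow, eval_C, eval_X]
      ring⟩,
    ⟨C (26 / 9) * X + C (-13 / 9), Polynomial.funext fun r => by
      simp only [secondPairThree, eval_sub, eval_add, eval_mul, eval_pow, eval_C, eval_X]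
      ring⟩⟩

theorem secondCurve_exists_addOrderOf_eq_48 :
    ∃ P : secondCurve.jacobianPoints, addOrderOf P = 48 :=
  secondCurve_rationalModel.exists_addOrderOf_eq_48 secondPair_collinear₂ secondPair_collinear₄ secondPair_collinear₆
    secondPair_collinear_last secondPairThree_collinear

/-! ### The third curve -/

/-- The polynomial `h² + 4f` of the third curve. -/
def thirdDisc : ℚ[X] :=
  C 4868 * X ^ 6 + C (-14604) * X ^ 5 + C 62871437 * X ^ 4 + C (-125718534) * X ^ 3 + C
  241613932017 * X ^ 2 + C (-241551075184) * X + C 323500201224256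

theorem thirdDisc_separable : thirdDisc.Separable := by
  have hd : derivative thirdDisc = C 29208 * X ^ 5 + C (-73020) * X ^ 4 + C 251485748 * X ^ 3 + C (-377155602) * X ^ 2 + C
      483227864034 * X + C (-241551075184) :=
    Polynomial.funext fun r => by
      simp [thirdDisc]
      ring
  rw [separable_def, hd]
  exact ⟨C (-877783 / 310408677432347007865139712) * X ^ 4 + C (877783 /
      155204338716173503932569856) * X ^ 3 + C (-32819114851 / 1862452064594082047190838272) * X
      ^ 2 + C (32813848153 / 1862452064594082047190838272) * X + C (5750061510173 /
      1862452064594082047190838272),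
    C (877783 / 1862452064594082047190838272) * X ^ 5 + C (-4388915 /
      3724904129188164094381676544) * X ^ 4 + C (840778363 / 169313824054007458835530752) * X ^
      3 + C (-3467662133 / 465613016148520511797709568) * X ^ 2 + C (38195936714731 /
      3724904129188164094381676544) * X + C (-340952588467 / 66516145164074358828244224),
    Polynomial.funext fun r => by
      simp only [thirdDisc, eval_one, eval_add, eval_mul, eval_pow, eval_C, eval_X]
      ring⟩

theorem thirdDisc_natDegree : thirdDisc.natDegree = 6 := by
  rw [thirdDisc]
  compute_degree!

theorem thirdDisc_eq : (X ^ 2 + X) ^ 2 + C (4 * 1) * sextic 2 = thirdDisc :=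
  Polynomial.funext fun r => by
    simp [sextic, thirdDisc]
    ring

/-- The third curve. -/
def thirdCurve : GenusTwoCurve ℚ where
  a := 1
  h := X ^ 2 + X
  f := sextic 2
  a_ne_zero := one_ne_zero
  natDegree_h_le := by compute_degree!
  natDegree_f_le := by
    simp only [sextic, Matrix.cons_val]
    compute_degree
  separable := by
    rw [thirdDisc_eq]
    exact thirdDisc_separable
  five_le_natDegree := by
    rw [thirdDisc_eq, thirdDisc_natDegree]
    norm_num

theorem thirdCurve_rationalModel :
    thirdCurve.RationalModel thirdDisc (thirdCurve.baseChange (AlgebraicClosure ℚ)).x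
      (thirdCurve.baseChange (AlgebraicClosure ℚ)).w 0 := by
  have hdisc : thirdCurve.disc = thirdDisc := thirdDisc_eq
  rw [← hdisc]
  apply GenusTwoCurve.rationalModel
  · rw [hdisc, thirdDisc_natDegree]
  · rw [hdisc]
    norm_num [thirdDisc]

/-- A divisor whose class has order `16`. -/
def thirdPair₁ : MumfordPair thirdDisc where
  u := X ^ 2 + C (-1219 / 2) * X + C (74529 / 2)
  v := C 23697424 * X + C (-1575878696)
  monic := by monicity!
  natDegree_eq := by compute_degree!
  dvd := ⟨C (-4868) * X ^ 4 + C (-2952442) * X ^ 3 + C (-1680981250) * X ^ 2 + C (-914411078432) * X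
      + C 66633663790080, Polynomial.funext fun r => by
      simp only [thirdDisc, eval_sub, eval_add, eval_mul, eval_pow, eval_C, eval_X]
      ring⟩
  isCoprime := ⟨C (1 / 1155), C (-1 / 27370524720) * X + C (181 / 9123508240),
    Polynomial.funext fun r => by
      simp only [eval_one, eval_add, eval_mul, eval_pow, eval_C, eval_X]
      ring⟩

/-- A divisor whose class is `-2` times that of `thirdPair₁`. -/
def thirdPair₂ : MumfordPair thirdDisc where
  u := X ^ 2 + C (-1) * X + C 5014
  v := C 8886534
  monic := by monicity!
  natDegree_eq := by compute_degree!
  dvd := ⟨C (-4868) * X ^ 4 + C 9736 * X ^ 3 + C (-38453549) * X ^ 2 + C 38448681 * X + C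
      (-48769388650), Polynomial.funext fun r => by
      simp only [thirdDisc, eval_sub, eval_add, eval_mul, eval_pow, eval_C, eval_X]
      ring⟩
  isCoprime := ⟨0, C (1 / 8886534),
    Polynomial.funext fun r => by
      simp only [eval_one, eval_zero, eval_add, eval_mul, eval_pow, eval_C, eval_X]
      ring⟩

/-- A divisor whose class is `-4` times that of `thirdPair₁`. -/
def thirdPair₄ : MumfordPair thirdDisc where
  u := X ^ 2 + C (-1) * X + C 2580
  v := C (-5924356)
  monic := by monicity!
  natDegree_eq := by compute_degree!
  dvd := ⟨C (-4868) * X ^ 4 + C 9736 * X ^ 3 + C (-50302261) * X ^ 2 + C 50297393 * X + C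
      (-111783801244), Polynomial.funext fun r => by
      simp only [thirdDisc, eval_sub, eval_add, eval_mul, eval_pow, eval_C, eval_X]
      ring⟩
  isCoprime := ⟨0, C (-1 / 5924356),
    Polynomial.funext fun r => by
      simp only [eval_one, eval_zero, eval_add, eval_mul, eval_pow, eval_C, eval_X]
      ring⟩

/-- A divisor whose class is `-6` times that of `thirdPair₁`. -/
def thirdPair₆ : MumfordPair thirdDisc where
  u := X ^ 2 + C (-1) * X + C (-2288)
  v := C 35546136
  monic := by monicity!
  natDegree_eq := by compute_degree!
  dvd := ⟨C (-4868) * X ^ 4 + C 9736 * X ^ 3 + C (-73999685) * X ^ 2 + C 73994817 * X + C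
      (-410851216480), Polynomial.funext fun r => by
      simp only [thirdDisc, eval_sub, eval_add, eval_mul, eval_pow, eval_C, eval_X]
      ring⟩
  isCoprime := ⟨0, C (1 / 35546136),
    Polynomial.funext fun r => by
      simp only [eval_one, eval_zero, eval_add, eval_mul, eval_pow, eval_C, eval_X]
      ring⟩

/-- A divisor whose class has order `3`. -/
def thirdPairThree : MumfordPair thirdDisc where
  u := X ^ 2 + C (-1) * X + C (67519 / 4)
  v := C (1481089 / 2) * X + C (-1481089 / 4)
  monic := by monicity!
  natDegree_eq := by compute_degree!
  dvd := ⟨C (-4868) * X ^ 4 + C 9736 * X ^ 3 + C 19308922 * X ^ 2 + C (-19313790) * X + C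
      (-76627461825 / 4), Polynomial.funext fun r => by
      simp only [thirdDisc, eval_sub, eval_add, eval_mul, eval_pow, eval_C, eval_X]
      ring⟩
  isCoprime := ⟨C (2 / 33759), C (-4 / 50000083551) * X + C (2 / 50000083551),
    Polynomial.funext fun r => by
      simp only [eval_one, eval_add, eval_mul, eval_pow, eval_C, eval_X]
      ring⟩

theorem thirdPair_collinear₂ : MumfordPair.Collinear thirdPair₁ thirdPair₁ thirdPair₂ :=
  ⟨C (2434 / 35) * X ^ 3 + C (1217 / 7) * X ^ 2 + C (12195557 / 35) * X + C (50534708 / 5), (-38944 / 1225), by norm_num, by compute_degree!,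
    Polynomial.funext fun r => by
      simp only [thirdDisc, thirdPair₁, thirdPair₂, eval_sub, eval_add, eval_mul, eval_pow, eval_C, eval_X]
      ring,
    ⟨C (2434 / 35) * X + C (1489608 / 35), Polynomial.funext fun r => by
      simp only [thirdPair₁, eval_sub, eval_add, eval_mul, eval_pow, eval_C, eval_X]
      ring⟩,
    ⟨C (2434 / 35) * X + C (1489608 / 35), Polynomial.funext fun r => by
      simp only [thirdPair₁, eval_sub, eval_add, eval_mul, eval_pow, eval_C, eval_X]
      ring⟩,
    ⟨C (2434 / 35) * X + C (1217 / 5), Polynomial.funext fun r => by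
      simp only [thirdPair₂, eval_sub, eval_add, eval_mul, eval_pow, eval_C, eval_X]
      ring⟩⟩

/-- Again a tangent to the elliptic quotient `w² = g(t)`, `t = X² - X`, now with leading coefficient
`4868`. The points in play have `t = -5014`, `-2580` and `2288`. -/
theorem thirdPair_collinear₄ : MumfordPair.Collinear thirdPair₂.conj thirdPair₂.conj thirdPair₄ :=
  ⟨C 1217 * X ^ 2 + C (-1217) * X + C (-2784496), (-4868), by norm_num, by compute_degree!,
    Polynomial.funext fun r => by
      simp only [thirdDisc, MumfordPair.conj, thirdPair₂, thirdPair₄, eval_sub, eval_add, eval_mul, eval_pow, eval_C, eval_X]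
      ring,
    ⟨C 1217, Polynomial.funext fun r => by
      simp only [MumfordPair.conj, thirdPair₂, eval_sub, eval_neg, eval_add, eval_mul, eval_pow, eval_C, eval_X]
      ring⟩,
    ⟨C 1217, Polynomial.funext fun r => by
      simp only [MumfordPair.conj, thirdPair₂, eval_sub, eval_neg, eval_add, eval_mul, eval_pow, eval_C, eval_X]
      ring⟩,
    ⟨C 1217, Polynomial.funext fun r => by
      simp only [thirdPair₄, eval_sub, eval_add, eval_mul, eval_pow, eval_C, eval_X]
      ring⟩⟩

theorem thirdPair_collinear₆ : MumfordPair.Collinear thirdPair₄.conj thirdPair₂.conj thirdPair₆ :=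
  ⟨C 6085 * X ^ 2 + C (-6085) * X + C 21623656, (-4868), by norm_num, by compute_degree!,
    Polynomial.funext fun r => by
      simp only [thirdDisc, MumfordPair.conj, thirdPair₂, thirdPair₄, thirdPair₆, eval_sub, eval_add, eval_mul, eval_pow, eval_C, eval_X]
      ring,
    ⟨C 6085, Polynomial.funext fun r => by
      simp only [MumfordPair.conj, thirdPair₄, eval_sub, eval_neg, eval_add, eval_mul, eval_pow, eval_C, eval_X]
      ring⟩,
    ⟨C 6085, Polynomial.funext fun r => by
      simp only [MumfordPair.conj, thirdPair₂, eval_sub, eval_neg, eval_add, eval_mul, eval_pow, eval_C, eval_X]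
      ring⟩,
    ⟨C 6085, Polynomial.funext fun r => by
      simp only [thirdPair₆, eval_sub, eval_add, eval_mul, eval_pow, eval_C, eval_X]
      ring⟩⟩

theorem thirdPair_collinear_last : MumfordPair.Collinear thirdPair₆.conj thirdPair₆.conj thirdPair₄.conj :=
  ⟨C (-8519) * X ^ 2 + C 8519 * X + C (-16054664), (-4868), by norm_num, by compute_degree!,
    Polynomial.funext fun r => by
      simp only [thirdDisc, MumfordPair.conj, thirdPair₄, thirdPair₆, eval_sub, eval_add, eval_mul, eval_pow, eval_C, eval_X]
      ring,
    ⟨C (-8519), Polynomial.funext fun r => by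
      simp only [MumfordPair.conj, thirdPair₆, eval_sub, eval_neg, eval_add, eval_mul, eval_pow, eval_C, eval_X]
      ring⟩,
    ⟨C (-8519), Polynomial.funext fun r => by
      simp only [MumfordPair.conj, thirdPair₆, eval_sub, eval_neg, eval_add, eval_mul, eval_pow, eval_C, eval_X]
      ring⟩,
    ⟨C (-8519), Polynomial.funext fun r => by
      simp only [MumfordPair.conj, thirdPair₄, eval_sub, eval_neg, eval_add, eval_mul, eval_pow, eval_C, eval_X]
      ring⟩⟩

theorem thirdPairThree_collinear : MumfordPair.Collinear thirdPairThree thirdPairThree thirdPairThree :=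
  ⟨C (-75454 / 1089) * X ^ 3 + C (37727 / 363) * X ^ 2 + C (-155743141 / 363) * X + C
      (233595848 / 1089), (-79757312 / 1185921), by norm_num, by compute_degree!,
    Polynomial.funext fun r => by
      simp only [thirdDisc, thirdPairThree, eval_sub, eval_add, eval_mul, eval_pow, eval_C, eval_X]
      ring,
    ⟨C (-75454 / 1089) * X + C (37727 / 1089), Polynomial.funext fun r => by
      simp only [thirdPairThree, eval_sub, eval_add, eval_mul, eval_pow, eval_C, eval_X]
      ring⟩,
    ⟨C (-75454 / 1089) * X + C (37727 / 1089), Polynomial.funext fun r => by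
      simp only [thirdPairThree, eval_sub, eval_add, eval_mul, eval_pow, eval_C, eval_X]
      ring⟩,
    ⟨C (-75454 / 1089) * X + C (37727 / 1089), Polynomial.funext fun r => by
      simp only [thirdPairThree, eval_sub, eval_add, eval_mul, eval_pow, eval_C, eval_X]
      ring⟩⟩

theorem thirdCurve_exists_addOrderOf_eq_48 :
    ∃ P : thirdCurve.jacobianPoints, addOrderOf P = 48 :=
  thirdCurve_rationalModel.exists_addOrderOf_eq_48 thirdPair_collinear₂ thirdPair_collinear₄ thirdPair_collinear₆
    thirdPair_collinear_last thirdPairThree_collinear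

/-! ### Isomorphisms with members of the family -/

theorem mem_adjoin_aeval_linear {K F : Type*} [Field K] [Field F] [Algebra K F] {a : K}
    (ha : a ≠ 0) (b : K) (x : F) :
    x ∈ IntermediateField.adjoin K {aeval x (C a * X + C b)} := by
  set L := IntermediateField.adjoin K {aeval x (C a * X + C b)}
  have h1 : aeval x (C a * X + C b) ∈ L := IntermediateField.mem_adjoin_simple_self K _
  have h2 : x = algebraMap K F a⁻¹ * (aeval x (C a * X + C b) - algebraMap K F b) := by
    have ha' : algebraMap K F a ≠ 0 := by simpa using ha
    simp [ha']
  rw [h2]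
  exact mul_mem (L.algebraMap_mem _) (sub_mem h1 (L.algebraMap_mem _))

theorem mem_adjoin_algebraMap_mul {K F : Type*} [Field K] [Field F] [Algebra K F] {a : K} (x : F)
    (ha : a ≠ 0) (y : F) : y ∈ IntermediateField.adjoin K {x, algebraMap K F a * y} := by
  set L := IntermediateField.adjoin K {x, algebraMap K F a * y}
  have h1 : algebraMap K F a * y ∈ L := IntermediateField.subset_adjoin _ _ (by simp)
  have h2 : y = algebraMap K F a⁻¹ * (algebraMap K F a * y) := by
    have ha' : algebraMap K F a ≠ 0 := by simpa using ha
    simp [ha']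
  rw [h2]
  exact mul_mem (L.algebraMap_mem _) h1

/-- The polynomial `4df` of the first member of the family. -/
def firstMemberDisc : ℚ[X] :=
  C 802816 * X ^ 6 + C (-5478365003776) * X ^ 4 + C 10380854590571544576 * X ^ 2 + C
  (-1869289605753484515213312)

theorem firstMemberDisc_separable : firstMemberDisc.Separable := by
  have hd : derivative firstMemberDisc = C 4816896 * X ^ 5 + C (-21913460015104) * X ^ 3 + C 20761709181143089152 * X :=
    Polynomial.funext fun r => by
      simp [firstMemberDisc]
      ring
  rw [separable_def, hd]
  exact ⟨C (-61 / 539742534073034392339441955164448096256) * X ^ 4 + C (5885 /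
      8067739567816800746464075780718592) * X ^ 2 + C (-1 / 1869289605753484515213312),
    C (61 / 3238455204438206354036651730986688577536) * X ^ 5 + C (-379 /
      2305068447947657356132593080205312) * X ^ 3 + C (31 / 93049082597506784757284864) * X,
    Polynomial.funext fun r => by
      simp only [firstMemberDisc, eval_one, eval_add, eval_mul, eval_pow, eval_C, eval_X]
      ring⟩

theorem firstMemberDisc_eq :
    (0 : ℚ[X]) ^ 2 + C (4 * 200704)
      * (X ^ 6 + C (-6823936) * X ^ 4 + C 12930552692736 * X ^ 2
        + C (-2328415982931935232)) = firstMemberDisc :=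
  Polynomial.funext fun r => by
    simp only [firstMemberDisc, eval_zero, eval_add, eval_mul, eval_pow, eval_C, eval_X]
    ring

/-- The member of the family with parameter `-21`. -/
def firstMember : GenusTwoCurve ℚ where
  a := 200704
  h := 0
  f := X ^ 6 + C (-6823936) * X ^ 4 + C 12930552692736 * X ^ 2
    + C (-2328415982931935232)
  a_ne_zero := by norm_num
  natDegree_h_le := by simp
  natDegree_f_le := by compute_degree!
  separable := by
    rw [firstMemberDisc_eq]
    exact firstMemberDisc_separable
  five_le_natDegree := by
    have : firstMemberDisc.natDegree = 6 := by
      rw [firstMemberDisc]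
      compute_degree!
    rw [firstMemberDisc_eq, this]
    norm_num

theorem firstMember_isMember : Family.IsMember (-21) firstMember := by
  refine ⟨?_, ?_, rfl, ?_⟩
  · norm_num [Family.c₀, Family.d]
  · norm_num [firstMember, Family.d]
  · norm_num [firstMember, Family.c₀, Family.c₂, Family.c₄]

theorem firstCurve_isomorphic : firstCurve.Isomorphic firstMember := by
  have h := firstCurve.isModel
  rw [show firstCurve.disc = firstDisc from firstDisc_eq] at h
  -- The new coordinate is `896(x - 1/2)`, which turns `x ↦ 1 - x` into a change of sign. Comparing
  -- leading coefficients gives the factor `896³ · 448` of `w`, where `448² = 200704` is the value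
  -- of `d`.
  apply GenusTwoCurve.isomorphic_of_isModel
    (x' := aeval firstCurve.x (C 896 * X + C (-448) : ℚ[X]))
    (y' := algebraMap ℚ _ 322256764928 * firstCurve.w)
  rw [show firstMember.disc = firstMemberDisc from firstMemberDisc_eq]
  refine h.change ?_ ?_ ?_
  · rw [mul_pow, h.sq_eq, ← aeval_comp, ← aeval_C (x := firstCurve.x), ← map_pow, ← map_mul]
    congr 1
    refine Polynomial.funext fun r => ?_
    simp only [firstDisc, firstMemberDisc, eval_comp, eval_add, eval_mul, eval_pow, eval_C, eval_X]
    ring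
  · exact mem_adjoin_aeval_linear (by norm_num) _ _
  · exact mem_adjoin_algebraMap_mul _ (by norm_num) _

/-- The polynomial `4df` of the second member of the family. -/
def secondMemberDisc : ℚ[X] :=
  C 8192 * X ^ 6 + C 184549376 * X ^ 4 + C (-824633720832) * X ^ 2 + C 17732923532771328

theorem secondMemberDisc_separable : secondMemberDisc.Separable := by
  have hd : derivative secondMemberDisc = C 49152 * X ^ 5 + C 738197504 * X ^ 3 + C (-1649267441664) * X :=
    Polynomial.funext fun r => by
      simp [secondMemberDisc]
      ring
  rw [separable_def, hd]
  exact ⟨C (-37 / 1218597226171546208103825408) * X ^ 4 + C (95 / 63751947518740210384896) * X ^ 2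
      + C (1 / 17732923532771328),
    C (37 / 7311583357029277248622952448) * X ^ 5 + C (-751 / 3570109061049451781554176) * X ^
      3 + C (-393 / 32281802128991715328) * X,
    Polynomial.funext fun r => by
      simp only [secondMemberDisc, eval_one, eval_add, eval_mul, eval_pow, eval_C, eval_X]
      ring⟩

theorem secondMemberDisc_eq :
    (0 : ℚ[X]) ^ 2 + C (4 * 2048)
      * (X ^ 6 + C 22528 * X ^ 4 + C (-100663296) * X ^ 2
        + C 2164663517184) = secondMemberDisc :=
  Polynomial.funext fun r => by
    simp only [secondMemberDisc, eval_zero, eval_add, eval_mul, eval_pow, eval_C, eval_X]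
    ring

/-- The member of the family with parameter `3`. -/
def secondMember : GenusTwoCurve ℚ where
  a := 2048
  h := 0
  f := X ^ 6 + C 22528 * X ^ 4 + C (-100663296) * X ^ 2
    + C 2164663517184
  a_ne_zero := by norm_num
  natDegree_h_le := by simp
  natDegree_f_le := by compute_degree!
  separable := by
    rw [secondMemberDisc_eq]
    exact secondMemberDisc_separable
  five_le_natDegree := by
    have : secondMemberDisc.natDegree = 6 := by
      rw [secondMemberDisc]
      compute_degree!
    rw [secondMemberDisc_eq, this]
    norm_num

theorem secondMember_isMember : Family.IsMember 3 secondMember := by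
  refine ⟨?_, ?_, rfl, ?_⟩
  · norm_num [Family.c₀, Family.d]
  · norm_num [secondMember, Family.d]
  · norm_num [secondMember, Family.c₀, Family.c₂, Family.c₄]

/-- The symmetry lives on `x⁻¹`, so the centred coordinate is `64(1 - 2x⁻¹)` and the second
generator is a multiple of `w / x³`; the factor `67108864 = 2²⁶` matches the leading coefficients.
-/
theorem isModel_of_secondDisc {F : Type*} [Field F] [Algebra ℚ F] {x w : F}
    (h : IsModel secondDisc x w) :
    IsModel secondMemberDisc (64 * (x - 2) / x) (67108864 * w / x ^ 3) := by
  have : CharZero F := algebraRat.charZero F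
  have hx : x ≠ 0 := by simpa using h.sub_algebraMap_ne_zero 0
  have hmem : x ∈ IntermediateField.adjoin ℚ {64 * (x - 2) / x} := by
    have h1 := IntermediateField.mem_adjoin_simple_self ℚ (64 * (x - 2) / x)
    have h2 : x = 128 / (64 - 64 * (x - 2) / x) := by
      have h3 : 64 - 64 * (x - 2) / x = 128 / x := by
        field_simp
        ring
      rw [h3]
      field_simp
    have h4 := div_mem (ofNat_mem _ 128) (sub_mem (ofNat_mem _ 64) h1)
    exact Eq.mpr (congrArg (· ∈ _) h2) h4
  refine h.change ?_ hmem ?_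
  · rw [div_pow, mul_pow, h.sq_eq, div_eq_iff (pow_ne_zero 2 (pow_ne_zero 3 hx))]
    simp only [secondDisc, secondMemberDisc, map_add, map_mul, map_pow, aeval_X, aeval_C]
    simp only [map_neg, map_ofNat]
    field_simp
    ring
  · set L := IntermediateField.adjoin ℚ {64 * (x - 2) / x, 67108864 * w / x ^ 3}
    have h1 : x ∈ L := IntermediateField.adjoin.mono ℚ _ _ (by simp) hmem
    have h2 : 67108864 * w / x ^ 3 ∈ L := IntermediateField.subset_adjoin _ _ (by simp)
    have h3 : w = 67108864 * w / x ^ 3 * x ^ 3 / 67108864 := by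
      field_simp
    rw [h3]
    exact div_mem (mul_mem h2 (pow_mem h1 3)) (ofNat_mem _ 67108864)


theorem secondCurve_isomorphic : secondCurve.Isomorphic secondMember := by
  have h := secondCurve.isModel
  rw [show secondCurve.disc = secondDisc from secondDisc_eq] at h
  exact GenusTwoCurve.isomorphic_of_isModel
    (show IsModel secondMember.disc _ _ by
      rw [show secondMember.disc = secondMemberDisc from secondMemberDisc_eq]
      exact isModel_of_secondDisc h)

/-- The polynomial `4df` of the third member of the family. -/
def thirdMemberDisc : ℚ[X] :=
  C (977027072 / 923521) * X ^ 6 + C (326691340270174208 / 27512614111) * X ^ 4 + C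
  (31242122658376888591608446976 / 787662783788549761) * X ^ 2 + C
  (1127489451927309800475716342513664 / 24417546297445042591)

theorem thirdMemberDisc_separable : thirdMemberDisc.Separable := by
  have hd : derivative thirdMemberDisc = C (5862162432 / 923521) * X ^ 5 + C (1306765361080696832 / 27512614111) * X ^ 3 + C
      (62484245316753777183216893952 / 787662783788549761) * X :=
    Polynomial.funext fun r => by
      simp [thirdMemberDisc]
      ring
  rw [separable_def, hd]
  exact ⟨C (-18280275478510415585948472199095048073 /
      697404742771775049068737700519831269260382549464714313728) * X ^ 4 + C
      (-184974181333084330922412686656253611 /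
      1303047166670398414584545588004906359477855229837312) * X ^ 2 + C (24417546297445042591 /
      1127489451927309800475716342513664),
    C (18280275478510415585948472199095048073 /
      4184428456630650294412426203118987615562295296788285882368) * X ^ 5 + C
      (417013335324704747441995487838071681 /
      10424377333363187316676364704039250875822841838698496) * X ^ 3 + C
      (828722114932743374162945349681293 / 11542013593664951943244628578558198337211727872) * X,
    Polynomial.funext fun r => by
      simp only [thirdMemberDisc, eval_one, eval_add, eval_mul, eval_pow, eval_C, eval_X]
      ring⟩

theorem thirdMemberDisc_eq :
    (0 : ℚ[X]) ^ 2 + C (4 * (244256768 / 923521))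
      * (X ^ 6 + C (334372864 / 29791) * X ^ 4 + C (31976721580931678208 / 852891037441) * X ^ 2
        + C (1154000215796794011942912 / 26439622160671)) = thirdMemberDisc :=
  Polynomial.funext fun r => by
    simp only [thirdMemberDisc, eval_zero, eval_add, eval_mul, eval_pow, eval_C, eval_X]
    ring

/-- The member of the family with parameter `21/31`. -/
def thirdMember : GenusTwoCurve ℚ where
  a := (244256768 / 923521)
  h := 0
  f := X ^ 6 + C (334372864 / 29791) * X ^ 4 + C (31976721580931678208 / 852891037441) * X ^ 2
    + C (1154000215796794011942912 / 26439622160671)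
  a_ne_zero := by norm_num
  natDegree_h_le := by simp
  natDegree_f_le := by compute_degree!
  separable := by
    rw [thirdMemberDisc_eq]
    exact thirdMemberDisc_separable
  five_le_natDegree := by
    have : thirdMemberDisc.natDegree = 6 := by
      rw [thirdMemberDisc]
      compute_degree!
    rw [thirdMemberDisc_eq, this]
    norm_num

theorem thirdMember_isMember : Family.IsMember (21 / 31) thirdMember := by
  refine ⟨?_, ?_, rfl, ?_⟩
  · norm_num [Family.c₀, Family.d]
  · norm_num [thirdMember, Family.d]
  · norm_num [thirdMember, Family.c₀, Family.c₂, Family.c₄]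

theorem thirdCurve_isomorphic : thirdCurve.Isomorphic thirdMember := by
  have h := thirdCurve.isModel
  rw [show thirdCurve.disc = thirdDisc from thirdDisc_eq] at h
  -- The same centring at `1/2`, with scale `896 / 31²`; the factor of `w` is accordingly `896³ ·
  -- 448 / 31⁸`.
  apply GenusTwoCurve.isomorphic_of_isModel
    (x' := aeval thirdCurve.x (C (896 / 961) * X + C (-448 / 961) : ℚ[X]))
    (y' := algebraMap ℚ _ (322256764928 / 852891037441) * thirdCurve.w)
  rw [show thirdMember.disc = thirdMemberDisc from thirdMemberDisc_eq]
  refine h.change ?_ ?_ ?_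
  · rw [mul_pow, h.sq_eq, ← aeval_comp, ← aeval_C (x := thirdCurve.x), ← map_pow, ← map_mul]
    congr 1
    refine Polynomial.funext fun r => ?_
    simp only [thirdDisc, thirdMemberDisc, eval_comp, eval_add, eval_mul, eval_pow, eval_C, eval_X]
    ring
  · exact mem_adjoin_aeval_linear (by norm_num) _ _
  · exact mem_adjoin_algebraMap_mul _ (by norm_num) _

end

/-! ### The parameters and the conclusion -/

theorem arisesFrom (i : Fin 3) :
    Family.ArisesFrom (parameter i) (pointOfD i).1 (pointOfD i).2 := by
  refine ⟨?_, ?_, ?_⟩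
  · rw [WeierstrassCurve.Affine.nonsingular_iff, WeierstrassCurve.Affine.equation_iff]
    fin_cases i <;> norm_num [pointOfD, Family.D]
  · fin_cases i <;> norm_num [pointOfD]
  · fin_cases i <;> norm_num [pointOfD, parameter]

theorem mainTheorem5 (i : Fin 3) :
    (∃ X₀ : GenusTwoCurve ℚ,
      (X₀.a = 1 ∧ X₀.h = X ^ 2 + X ∧ X₀.f = sextic i) ∧
      (∃ P : X₀.jacobianPoints, addOrderOf P = 48) ∧
      ∃ X₁ : GenusTwoCurve ℚ, Family.IsMember (parameter i) X₁ ∧ X₀.Isomorphic X₁) ∧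
    Family.ArisesFrom (parameter i) (pointOfD i).1 (pointOfD i).2 := by
  refine ⟨?_, arisesFrom i⟩
  fin_cases i
  · exact ⟨firstCurve, ⟨rfl, rfl, rfl⟩, firstCurve_exists_addOrderOf_eq_48, firstMember,
      firstMember_isMember, firstCurve_isomorphic⟩
  · exact ⟨secondCurve, ⟨rfl, rfl, rfl⟩, secondCurve_exists_addOrderOf_eq_48, secondMember,
      secondMember_isMember, secondCurve_isomorphic⟩
  · exact ⟨thirdCurve, ⟨rfl, rfl, rfl⟩, thirdCurve_exists_addOrderOf_eq_48, thirdMember,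
      thirdMember_isMember, thirdCurve_isomorphic⟩
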